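/- Throughout, $\otimes$ is the minimal tensor product of $C^*$-algebras. Let $N\ge 4$. Let $\mathcal C_N$ be the category whose objects are pairs $(D,M)$ of a $C^*$-algebra $D$ and a matrix $M=(m_{ij})\in M_N(D)$ whose entries generate $D$ as a $C^*$-algebra, and whose arrows $(D,M)\to(D',M')$ are the $*$-homomorphisms $\varphi:D\to D'$ with $\varphi(m_{ij})=m'_{ij}$ for all $i,j$ (there is at most one arrow between two objects). For matrices $X\in M_N(A)$ and $Y\in M_N(B)$ over $C^*$-algebras $A,B$ let $X⦶Y\in M_N(A\otimes B)$ be the matrix with entries $\sum_{k=1}^N x_{ik}\otimes y_{kj}$. Let $A=C^*(p,q,1)$ be the universal unital $C^*$-algebra generated by two projections $p,q$. For pairwise different $a,b,c,d\in\{1,\dots,N\}$ let $R_{(a,b),(c,d)}\in M_N(A)$ be the matrix with entries $p$ at $(a,a)$ and $(b,b)$, $q$ at $(c,c)$ and $(d,d)$, $1$ at all other diagonal positions, $1-p$ at $(a,b)$ and $(b,a)$, $1-q$ at $(c,d)$ and $(d,c)$, and $0$ at all other off-diagonal positions. Let $L\ge 1$ be an integer such that every permutation in $S_N$ is a product of at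 most $L$ transpositions. For each pair $a<b$ choose $c,d$ such that $a,b,c,d$ are pairwise different, and put $R_{(a,b),*}=R_{(a,b),(c,d)}$. Define $$M_1=\Big(\underset{1\le a<b\le N}{⦶} R_{(a,b),*}\Big)^{⦶ L},$$ the product over the pairs being taken in an arbitrary order, and let $B_1$ be the $C^*$-algebra generated by the entries of $M_1$. For $n\ge1$ let $M_n=M_1^{⦶ n}$, a matrix over $B_1^{\otimes n}$, and let $B_n\subseteq B_1^{\otimes n}$ be the $C^*$-algebra generated by the entries of $M_n$. **Theorem.** For every $n\ge 1$ there is a (unique) arrow $\pi_{n+1,n}:(B_{n+1},M_{n+1})\to(B_n,M_n)$ in $\mathcal C_N$, and the resulting inverse system has an inverse limit $(B_\infty,M_\infty)$, $M_\infty=(m_{ij})$, in $\mathcal C_N$. This limit is a compact matrix quantum group: $B_\infty$ is unital, $M_\infty$ is unitary, $(m_{ij}^*)_{i,j}$ is invertible, and there is a unital $*$-homomorphism $\Delta:B_\infty\to B_\infty\otimes B_\infty$ with $$\Delta(m_{ij})=\sum_{k=1}^N m_{ik}\otimes m_{kj}\qquad(1\le i,j\le N).$$ Moreover, this comultiplication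 $\Delta$ is isometric. -/

import Mathlib

open scoped ENNReal TensorProduct

noncomputable section

universe u v

/-! ## Generated C⋆-subalgebras -/

section Generated

variable {A : Type u} [NonUnitalCStarAlgebra A]

/-- The C⋆-subalgebra `C⋆(s)` of `A` generated by a set `s`: the norm closure of the (non-unital)
`*`-subalgebra generated by `s`. -/
def cstarGen (s : Set A) : NonUnitalStarSubalgebra ℂ A :=
  (NonUnitalStarAlgebra.adjoin ℂ s).topologicalClosure

instance cstarGen_isClosed (s : Set A) : IsClosed (cstarGen s : Set A) :=
  NonUnitalStarSubalgebra.isClosed_topologicalClosure _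

theorem mem_cstarGen {s : Set A} {x : A} (hx : x ∈ s) : x ∈ cstarGen s :=
  NonUnitalStarSubalgebra.le_topologicalClosure _ (NonUnitalStarAlgebra.subset_adjoin ℂ s hx)

/-- `C⋆(s)` as a C⋆-algebra of its own. -/
def CStarGen (s : Set A) : Type u := ↥(cstarGen s)

instance (s : Set A) : NonUnitalCStarAlgebra (CStarGen s) :=
  NonUnitalStarSubalgebra.nonUnitalCStarAlgebra (cstarGen s)

/-- The inclusion of `C⋆(s)` into `A`. -/
def CStarGen.incl (s : Set A) : CStarGen s →⋆ₙₐ[ℂ] A :=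
  NonUnitalStarSubalgebraClass.subtype (cstarGen s)

/-- An element of `s` as an element of `C⋆(s)`. -/
def CStarGen.of {s : Set A} (x : A) (hx : x ∈ s) : CStarGen s := ⟨x, mem_cstarGen hx⟩

/-- The generators of `C⋆(s)` also generate it as a C⋆-algebra of its own. -/
theorem cstarGen_eq_top (s : Set A) (t : Set (CStarGen s))
    (ht : ∀ x (hx : x ∈ s), CStarGen.of x hx ∈ t) : cstarGen t = ⊤ := by
  have key : ∀ x ∈ NonUnitalStarAlgebra.adjoin ℂ s,
      ∃ y ∈ NonUnitalStarAlgebra.adjoin ℂ t, CStarGen.incl s y = x := by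
    intro x hx
    induction hx using NonUnitalStarAlgebra.adjoin_induction with
    | mem x hx => exact ⟨CStarGen.of x hx, NonUnitalStarAlgebra.subset_adjoin ℂ _ (ht x hx), rfl⟩
    | add x y _ _ hx hy =>
      obtain ⟨a, ha, rfl⟩ := hx
      obtain ⟨b, hb, rfl⟩ := hy
      exact ⟨a + b, add_mem ha hb, map_add _ _ _⟩
    | zero => exact ⟨0, zero_mem _, map_zero _⟩
    | mul x y _ _ hx hy =>
      obtain ⟨a, ha, rfl⟩ := hx
      obtain ⟨b, hb, rfl⟩ := hy
      exact ⟨a * b, mul_mem ha hb, map_mul _ _ _⟩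
    | smul r x _ hx =>
      obtain ⟨a, ha, rfl⟩ := hx
      exact ⟨r • a, SMulMemClass.smul_mem r ha, map_smul _ _ _⟩
    | star x _ hx =>
      obtain ⟨a, ha, rfl⟩ := hx
      exact ⟨star a, star_mem ha, map_star _ _⟩
  have hind : Topology.IsInducing (CStarGen.incl s) := Topology.IsInducing.subtypeVal
  rw [eq_top_iff]
  intro x _
  change x ∈ closure (NonUnitalStarAlgebra.adjoin ℂ t : Set (CStarGen s))
  rw [hind.closure_eq_preimage_closure_image]
  have hx : CStarGen.incl s x ∈ closure (NonUnitalStarAlgebra.adjoin ℂ s : Set A) := x.2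
  refine closure_mono ?_ hx
  intro z hz
  obtain ⟨y, hy, rfl⟩ := key z hz
  exact ⟨y, hy, rfl⟩

end Generated

/-! ## The minimal tensor product -/

section GNS

attribute [local instance] CStarAlgebra.spectralOrder CStarAlgebra.spectralOrderedRing

open scoped ComplexOrder

/-- Positive linear functionals on a C⋆-algebra (with its usual order). -/
abbrev PosFunctional (A : Type u) [NonUnitalCStarAlgebra A] : Type u := A →ₚ[ℂ] ℂ

variable {A : Type u} [NonUnitalCStarAlgebra A]

/-- The Hilbert space of the GNS representation of a positive functional. -/
abbrev GNSSpace (f : PosFunctional A) : Type u := f.GNS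

/-- The GNS representation of a positive functional. -/
abbrev gnsRep (f : PosFunctional A) : A →⋆ₙₐ[ℂ] (GNSSpace f →L[ℂ] GNSSpace f) :=
  f.gnsNonUnitalStarAlgHom

end GNS

section MinTensor

variable {A : Type u} [NonUnitalCStarAlgebra A] {B : Type v} [NonUnitalCStarAlgebra B]

/-- The Hilbert space tensor product of two GNS spaces. -/
def GNSTensor (i : PosFunctional A × PosFunctional B) : Type (max u v) :=
  UniformSpace.Completion (GNSSpace i.1 ⊗[ℂ] GNSSpace i.2)

instance (i : PosFunctional A × PosFunctional B) : NormedAddCommGroup (GNSTensor i) :=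
  inferInstanceAs (NormedAddCommGroup (UniformSpace.Completion (GNSSpace i.1 ⊗[ℂ] GNSSpace i.2)))

instance (i : PosFunctional A × PosFunctional B) : InnerProductSpace ℂ (GNSTensor i) :=
  inferInstanceAs
    (InnerProductSpace ℂ (UniformSpace.Completion (GNSSpace i.1 ⊗[ℂ] GNSSpace i.2)))

instance (i : PosFunctional A × PosFunctional B) : CompleteSpace (GNSTensor i) :=
  inferInstanceAs (CompleteSpace (UniformSpace.Completion (GNSSpace i.1 ⊗[ℂ] GNSSpace i.2)))

/-- The operator `π_f(a) ⊗ π_g(b)` on the Hilbert space `H_f ⊗ H_g`. -/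
def gnsTensorOp (a : A) (b : B) (i : PosFunctional A × PosFunctional B) :
    GNSTensor i →L[ℂ] GNSTensor i :=
  (TensorProduct.mapL (gnsRep i.1 a) (gnsRep i.2 b)).completion

theorem norm_gnsTensorOp_le (a : A) (b : B) (i : PosFunctional A × PosFunctional B) :
    ‖gnsTensorOp a b i‖ ≤ ‖a‖ * ‖b‖ := by
  have hT : ‖TensorProduct.mapL (gnsRep i.1 a) (gnsRep i.2 b)‖ ≤ ‖a‖ * ‖b‖ := by
    refine (TensorProduct.norm_mapL_le _ _).trans ?_
    gcongr
    · exact NonUnitalStarAlgHom.norm_apply_le (gnsRep i.1) a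
    · exact NonUnitalStarAlgHom.norm_apply_le (gnsRep i.2) b
  have hc : ∀ x : UniformSpace.Completion (GNSSpace i.1 ⊗[ℂ] GNSSpace i.2),
      ‖(TensorProduct.mapL (gnsRep i.1 a) (gnsRep i.2 b)).completion x‖ ≤ ‖a‖ * ‖b‖ * ‖x‖ := by
    intro x
    induction x using UniformSpace.Completion.induction_on with
    | hp => exact isClosed_le (by fun_prop) (by fun_prop)
    | ih x =>
      rw [ContinuousLinearMap.completion_apply_coe, UniformSpace.Completion.norm_coe,
        UniformSpace.Completion.norm_coe]
      exact (ContinuousLinearMap.le_opNorm _ x).trans (by gcongr)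
  exact ContinuousLinearMap.opNorm_le_bound _ (by positivity) hc

/-- The C⋆-algebra of bounded families of operators on the Hilbert spaces `H_f ⊗ H_g`,
where `f` and `g` run through all positive functionals of `A` and `B`. -/
abbrev GNSTensorOps (A : Type u) [NonUnitalCStarAlgebra A] (B : Type v)
    [NonUnitalCStarAlgebra B] : Type (max u v) :=
  lp (fun i : PosFunctional A × PosFunctional B => GNSTensor i →L[ℂ] GNSTensor i) ∞

/-- The family `(π_f(a) ⊗ π_g(b))` indexed by all pairs `(f, g)`. -/
def elemTensor (a : A) (b : B) : GNSTensorOps A B :=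
  ⟨gnsTensorOp a b, memℓp_infty ⟨‖a‖ * ‖b‖, by
    rintro _ ⟨i, rfl⟩
    exact norm_gnsTensorOp_le a b i⟩⟩

/-- The minimal tensor product `A ⊗ B` of two C⋆-algebras: the completion of the algebraic
tensor product for the norm `sup ‖(ξ₁ ⊗ ξ₂)(x)‖` over all pairs of representations
`ξ₁` of `A` and `ξ₂` of `B` on Hilbert spaces. Since every representation is a direct sum of
cyclic representations and a null representation, and the cyclic ones are the GNS representations,
it suffices to let `ξ₁`, `ξ₂` run through the GNS representations of all positive functionals. -/
def MinTensor (A : Type u) [NonUnitalCStarAlgebra A] (B : Type v)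
    [NonUnitalCStarAlgebra B] : Type (max u v) :=
  CStarGen (Set.range fun x : A × B => elemTensor x.1 x.2)

instance (A : Type u) [NonUnitalCStarAlgebra A] (B : Type v) [NonUnitalCStarAlgebra B] :
    NonUnitalCStarAlgebra (MinTensor A B) :=
  inferInstanceAs (NonUnitalCStarAlgebra (CStarGen (Set.range fun x : A × B => elemTensor x.1 x.2)))

/-- The elementary tensor `a ⊗ b` in the minimal tensor product. -/
def minTmul (a : A) (b : B) : MinTensor A B :=
  CStarGen.of (elemTensor a b) ⟨(a, b), rfl⟩

end MinTensor

/-! ## The categories `𝒞_N` and compact matrix quantum groups -/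

/-- A C⋆-algebra together with an `N × N` matrix over it. -/
structure MatPair (N : ℕ) where
  carrier : Type u
  [cstar : NonUnitalCStarAlgebra carrier]
  mat : Matrix (Fin N) (Fin N) carrier

attribute [instance] MatPair.cstar

/-- The set of entries of the matrix. -/
def MatPair.entries {N : ℕ} (X : MatPair.{u} N) : Set X.carrier :=
  Set.range fun ij : Fin N × Fin N => X.mat ij.1 ij.2

/-- The objects `(D, M)` of the category `𝒞_N`: the C⋆-algebra `D` is generated by the entries
of the matrix `M`. -/
structure CatObj (N : ℕ) extends MatPair.{u} N where
  generated : cstarGen toMatPair.entries = ⊤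

/-- The arrows of `𝒞_N`: `*`-homomorphisms mapping the matrix entrywise to the matrix. -/
structure CatArrow {N : ℕ} (X : CatObj.{u} N) (Y : CatObj.{v} N) where
  hom : X.carrier →⋆ₙₐ[ℂ] Y.carrier
  map_mat : ∀ i j, hom (X.mat i j) = Y.mat i j

/-- There is at most one arrow between two objects of `𝒞_N`. -/
instance {N : ℕ} (X : CatObj.{u} N) (Y : CatObj.{v} N) : Subsingleton (CatArrow X Y) := by
  constructor
  rintro ⟨f, hf⟩ ⟨g, hg⟩
  have hadj : Set.EqOn f g (NonUnitalStarAlgebra.adjoin ℂ X.entries) := by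
    intro x hx
    induction hx using NonUnitalStarAlgebra.adjoin_induction with
    | mem x hx => obtain ⟨ij, rfl⟩ := hx; rw [hf, hg]
    | add x y _ _ hx hy => rw [map_add, map_add, hx, hy]
    | zero => rw [map_zero, map_zero]
    | mul x y _ _ hx hy => rw [map_mul, map_mul, hx, hy]
    | smul r x _ hx => rw [map_smul, map_smul, hx]
    | star x _ hx => rw [map_star, map_star, hx]
  have hcont : ∀ h : X.carrier →⋆ₙₐ[ℂ] Y.carrier, Continuous h := fun h =>
    AddMonoidHomClass.continuous_of_bound h 1 fun a => by
      simpa using NonUnitalStarAlgHom.norm_apply_le h a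
  have hall : f = g := by
    ext x
    have hx : x ∈ cstarGen X.entries := by rw [X.generated]; trivial
    exact hadj.closure (hcont f) (hcont g) hx
  subst hall
  rfl

/-- `(C⋆(m_ij), M)`, the object of `𝒞_N` obtained by passing to the C⋆-subalgebra generated by the
entries of the matrix. -/
def MatPair.generatedObj {N : ℕ} (X : MatPair.{u} N) : CatObj.{u} N where
  carrier := CStarGen X.entries
  mat := fun i j => CStarGen.of (X.mat i j) ⟨(i, j), rfl⟩
  generated := by
    refine cstarGen_eq_top _ _ ?_
    rintro _ ⟨ij, rfl⟩
    exact ⟨ij, rfl⟩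

/-- `e` is a unit element of the C⋆-algebra `A`. -/
def IsUnitElement {A : Type u} [NonUnitalCStarAlgebra A] (e : A) : Prop :=
  ∀ a : A, e * a = a ∧ a * e = a

/-- `Δ` is a comultiplication on `(A, u)`: a unital `*`-homomorphism into the minimal tensor
product `A ⊗ A` with `Δ(u_ij) = ∑ k, u_ik ⊗ u_kj`. -/
structure IsComultiplication {N : ℕ} (X : CatObj.{u} N)
    (Δ : X.carrier →⋆ₙₐ[ℂ] MinTensor X.carrier X.carrier) : Prop where
  map_unit : ∀ e : X.carrier, IsUnitElement e → IsUnitElement (Δ e)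
  map_mat : ∀ i j, Δ (X.mat i j) = ∑ k, minTmul (X.mat i k) (X.mat k j)

/-- The object `(A, u)` of `𝒞_N` is a compact matrix quantum group: `A` is unital, `u` is unitary,
the entrywise adjoint of `u` is invertible, and there is a comultiplication. -/
def IsCompactMatrixQuantumGroup {N : ℕ} (X : CatObj.{u} N) : Prop :=
  ∃ e : X.carrier, IsUnitElement e ∧
    X.mat * X.mat.conjTranspose = Matrix.diagonal (fun _ => e) ∧
    X.mat.conjTranspose * X.mat = Matrix.diagonal (fun _ => e) ∧
    (∃ V : Matrix (Fin N) (Fin N) X.carrier,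
      X.mat.map star * V = Matrix.diagonal (fun _ => e) ∧
      V * X.mat.map star = Matrix.diagonal (fun _ => e)) ∧
    ∃ Δ : X.carrier →⋆ₙₐ[ℂ] MinTensor X.carrier X.carrier, IsComultiplication X Δ

/-! ## Inverse limits in `𝒞_N` -/

/-- A cone in `𝒞_N` over the inverse system with objects `D n` and arrows `π n : D (n+1) → D n`. -/
structure CatCone {N : ℕ} {D : ℕ → CatObj.{u} N} (π : ∀ n, CatArrow (D (n + 1)) (D n)) where
  pt : CatObj.{u} N
  arrow : ∀ n, CatArrow pt (D n)
  comm : ∀ n a, (π n).hom ((arrow (n + 1)).hom a) = (arrow n).hom a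

/-- The cone is an inverse limit of the system: every other cone factors through it. The
factorization is unique since there is at most one arrow between two objects of `𝒞_N`. -/
def CatCone.IsInverseLimit {N : ℕ} {D : ℕ → CatObj.{u} N}
    {π : ∀ n, CatArrow (D (n + 1)) (D n)} (C : CatCone π) : Prop :=
  ∀ C' : CatCone π, ∃ ψ : CatArrow C'.pt C.pt,
    ∀ n a, (C.arrow n).hom (ψ.hom a) = (C'.arrow n).hom a

/-! ## The Woronowicz product -/

/-- The Woronowicz product `M₁ ⦶ M₂`, with entries `∑ k, m⁽¹⁾_ik ⊗ m⁽²⁾_kj` in `A ⊗ B`. -/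
def MatPair.wprod {N : ℕ} (X : MatPair.{u} N) (Y : MatPair.{v} N) : MatPair.{max u v} N where
  carrier := MinTensor X.carrier Y.carrier
  mat := fun i j => ∑ k, minTmul (X.mat i k) (Y.mat k j)

/-- The product `X₀ ⦶ X₁ ⦶ ⋯ ⦶ X_k` of a nonempty finite sequence, bracketed to the left. -/
def MatPair.wprodList {N : ℕ} (X₀ : MatPair.{u} N) (l : List (MatPair.{u} N)) : MatPair.{u} N :=
  l.foldl MatPair.wprod X₀

/-- The power `X ⦶ ⋯ ⦶ X` with `n ≥ 1` factors. -/
def MatPair.wpow {N : ℕ} (X : MatPair.{u} N) (n : ℕ+) : MatPair.{u} N :=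
  X.wprodList (List.replicate n.natPred X)

/-! ## The universal C⋆-algebra generated by two projections -/

/-- A representation of the generators and relations: projections `e, p, q` in a C⋆-algebra such
that `e p = p e = p` and `e q = q e = q`. -/
structure TwoProjRep where
  alg : Type
  [cstar : NonUnitalCStarAlgebra alg]
  e : alg
  p : alg
  q : alg
  e_proj : IsStarProjection e
  p_proj : IsStarProjection p
  q_proj : IsStarProjection q
  e_mul_p : e * p = p
  p_mul_e : p * e = p
  e_mul_q : e * q = q
  q_mul_e : q * e = q

attribute [instance] TwoProjRep.cstar

/-- Bounded families indexed by all representations of the generators and relations. -/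
abbrev TwoProjFamily : Type 1 := lp (fun r : TwoProjRep => r.alg) ∞

/-- A family of projections, as a bounded family. -/
def projFamily (x : ∀ r : TwoProjRep, r.alg) (hx : ∀ r, IsStarProjection (x r)) : TwoProjFamily :=
  ⟨x, memℓp_infty ⟨1, by
    rintro _ ⟨r, rfl⟩
    exact (hx r).norm_le⟩⟩

/-- The generators `1`, `p`, `q` in the product of all representations. -/
def twoProjFamilyGen : Fin 3 → TwoProjFamily :=
  ![projFamily TwoProjRep.e TwoProjRep.e_proj, projFamily TwoProjRep.p TwoProjRep.p_proj,
    projFamily TwoProjRep.q TwoProjRep.q_proj]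

/-- The universal C⋆-algebra `C⋆(p, q, 1 | p, q, 1 projections, 1p = p1 = p, 1q = q1 = q)`: the
norm of a `*`-polynomial in the generators is the supremum of its norms over all representations of
the generators and relations. -/
def TwoProj : Type 1 := CStarGen (Set.range twoProjFamilyGen)

instance : NonUnitalCStarAlgebra TwoProj :=
  inferInstanceAs (NonUnitalCStarAlgebra (CStarGen (Set.range twoProjFamilyGen)))

/-- The unit of the universal C⋆-algebra generated by two projections. -/
def TwoProj.unit : TwoProj := CStarGen.of (twoProjFamilyGen 0) ⟨0, rfl⟩

/-- The first generating projection. -/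
def TwoProj.p : TwoProj := CStarGen.of (twoProjFamilyGen 1) ⟨1, rfl⟩

/-- The second generating projection. -/
def TwoProj.q : TwoProj := CStarGen.of (twoProjFamilyGen 2) ⟨2, rfl⟩

/-! ## The sequence of models -/

/-- The matrix `R_{(a,b),(c,d)}` over the universal C⋆-algebra generated by two projections. -/
def matR {N : ℕ} (a b c d : Fin N) : MatPair.{1} N where
  carrier := TwoProj
  mat := fun i j =>
    if i = j then
      if i = a ∨ i = b then TwoProj.p else if i = c ∨ i = d then TwoProj.q else TwoProj.unit
    else if (i = a ∧ j = b) ∨ (i = b ∧ j = a) then TwoProj.unit - TwoProj.p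
    else if (i = c ∧ j = d) ∨ (i = d ∧ j = c) then TwoProj.unit - TwoProj.q
    else 0

/-- The object `(B₁, M₁)`: `M₁` is the `L`-th power of the product of the matrices `R_{(a,b),*}`,
where `(a, b)` runs through the nonempty list `p₀ :: ps` and `R_{(a,b),*}` stands for
`R_{(a,b),(c(a,b),d(a,b))}`, and `B₁` is generated by the entries of `M₁`. -/
def modelOne {N : ℕ} (L : ℕ+) (c d : Fin N → Fin N → Fin N) (p₀ : Fin N × Fin N)
    (ps : List (Fin N × Fin N)) : CatObj.{1} N :=
  (((matR p₀.1 p₀.2 (c p₀.1 p₀.2) (d p₀.1 p₀.2)).wprodList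
    (ps.map fun p => matR p.1 p.2 (c p.1 p.2) (d p.1 p.2))).wpow L).generatedObj

/-- For an object `(B₁, M₁)`, the object `(Bₙ, Mₙ)`: `Mₙ` is the `n`-th power of `M₁` and
`Bₙ ⊆ B₁ ⊗ ⋯ ⊗ B₁` is generated by the entries of `Mₙ`. -/
def CatObj.model {N : ℕ} (X : CatObj.{u} N) (n : ℕ+) : CatObj.{u} N :=
  (X.toMatPair.wpow n).generatedObj

end

noncomputable section

universe u v w

open scoped CStarAlgebra Matrix

/-!
Product functionals separate the points of a minimal tensor product, so a map given on elementary
tensors extends to a `*`-homomorphism as soon as sufficiently many functionals are compatible with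
it. In particular every counit `ε`, that is, every `*`-homomorphism with `ε (m_ij) = δ_ij`, has a
slice map `id ⊗ ε`, which maps `M ⦶ M'` to `M` when `ε` is a counit of `M'`.

The matrices `R_{(a,b),(c,d)}` and their entrywise adjoints are unitary, and `p, q, 1 ↦ 1` is a
counit; both properties pass to products and hence to `M₁`. Slicing off the last factor of
`M_{n+1} = M_n ⦶ M₁` gives the arrows of the inverse system. Its limit is generated by the sequences
`(M_n)_n` in the product of the C⋆-algebras `B_n`, so the maps to the `B_n` separate its points, and
therefore so do their tensor products on `B_∞ ⊗ B_∞`. Through these one lifts the homomorphisms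
`B_∞ → B_n ⊗ B_m` given by `M_{n+m} = M_n ⦶ M_m`, which yields `Δ`. Finally `B_∞` has a counit as
well, and slicing with it is a left inverse of `Δ`.
-/

/-! ## Generated C⋆-algebras and their homomorphisms -/

section Generated

variable {A : Type u} [NonUnitalCStarAlgebra A] {B : Type v} [NonUnitalCStarAlgebra B]

theorem cstarGen_le {s : Set A} {S : NonUnitalStarSubalgebra ℂ A} (hS : IsClosed (S : Set A))
    (h : s ⊆ S) : cstarGen s ≤ S :=
  NonUnitalStarSubalgebra.topologicalClosure_minimal _ (NonUnitalStarAlgebra.adjoin_le h) hS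

theorem mem_of_cstarGen_eq_top {s : Set A} (hs : cstarGen s = ⊤)
    {S : NonUnitalStarSubalgebra ℂ A} (hS : IsClosed (S : Set A)) (h : s ⊆ S) (x : A) : x ∈ S :=
  cstarGen_le hS h (hs ▸ NonUnitalStarAlgebra.mem_top)

theorem hom_ext_of_cstarGen_eq_top {s : Set A} (hs : cstarGen s = ⊤) {φ ψ : A →⋆ₙₐ[ℂ] B}
    (h : Set.EqOn φ ψ s) : φ = ψ :=
  DFunLike.ext _ _ <| mem_of_cstarGen_eq_top hs (S := NonUnitalStarAlgHom.equalizer φ ψ)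
    (isClosed_eq (map_continuous φ) (map_continuous ψ)) h

theorem map_mem_cstarGen {s : Set A} (hs : cstarGen s = ⊤) {t : Set B} (φ : A →⋆ₙₐ[ℂ] B)
    (h : ∀ x ∈ s, φ x ∈ cstarGen t) (x : A) : φ x ∈ cstarGen t :=
  mem_of_cstarGen_eq_top hs (S := (cstarGen t).comap φ)
    ((cstarGen_isClosed t).preimage (map_continuous φ)) h x

theorem CStarGen.incl_injective (s : Set A) : Function.Injective (CStarGen.incl s) :=
  Subtype.val_injective

theorem mem_span_of_mem_adjoin {s : Set A} (hmul : ∀ x ∈ s, ∀ y ∈ s, x * y ∈ s)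
    (hstar : ∀ x ∈ s, star x ∈ s) {x : A} (hx : x ∈ NonUnitalStarAlgebra.adjoin ℂ s) :
    x ∈ Submodule.span ℂ s := by
  have hunion : s ∪ star s = s := Set.union_eq_self_of_subset_right fun y hy => by
    simpa using hstar _ (Set.mem_star.mp hy)
  have hclosure : (Subsemigroup.closure s : Set A) = s :=
    congrArg SetLike.coe
      (Subsemigroup.closure_eq (⟨s, fun ha hb => hmul _ ha _ hb⟩ : Subsemigroup A))
  have hspan := NonUnitalStarAlgebra.adjoin_eq_span (R := ℂ) s
  rw [hunion, hclosure] at hspan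
  exact hspan ▸ hx

/-- The projection `K → A` is injective, hence isometric, so its range is closed and contains the
algebra generated by `s`. -/
theorem exists_hom_of_isClosed_graph (K : NonUnitalStarSubalgebra ℂ (A × B))
    (hK : IsClosed (K : Set (A × B))) (hK₀ : ∀ y, ((0, y) : A × B) ∈ K → y = 0) {s : Set A}
    (hs : cstarGen s = ⊤) (hsK : ∀ x ∈ s, ∃ y, (x, y) ∈ K) :
    ∃ φ : A →⋆ₙₐ[ℂ] B, ∀ x y, (x, y) ∈ K ↔ φ x = y := by
  let _ : NonUnitalCStarAlgebra K := NonUnitalStarSubalgebra.nonUnitalCStarAlgebra K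
  let fst : K →⋆ₙₐ[ℂ] A :=
    (NonUnitalStarAlgHom.fst ℂ A B).comp (NonUnitalStarSubalgebraClass.subtype K)
  let snd : K →⋆ₙₐ[ℂ] B :=
    (NonUnitalStarAlgHom.snd ℂ A B).comp (NonUnitalStarSubalgebraClass.subtype K)
  have hinj : Function.Injective fst := by
    rw [injective_iff_map_eq_zero]
    rintro ⟨⟨x, y⟩, hz⟩ (rfl : x = 0)
    exact Subtype.ext (Prod.ext rfl (hK₀ y hz))
  have hclosed : IsClosed (NonUnitalStarAlgHom.range fst : Set A) := by
    rw [NonUnitalStarAlgHom.coe_range]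
    exact (NonUnitalStarAlgHom.isometry fst hinj).isClosedEmbedding.isClosed_range
  have hsurj : Function.Surjective fst := mem_of_cstarGen_eq_top hs hclosed fun x hx =>
    (hsK x hx).elim fun y hy => ⟨⟨(x, y), hy⟩, rfl⟩
  let e : K ≃⋆ₐ[ℂ] A := StarAlgEquiv.ofBijective fst ⟨hinj, hsurj⟩
  have mem_iff : ∀ x y, (x, y) ∈ K ↔ snd (e.symm x) = y := by
    refine fun x y => ⟨fun h => ?_, ?_⟩
    · have hx : e.symm x = ⟨(x, y), h⟩ := (StarAlgEquiv.symm_apply_eq e).mpr rfl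
      rw [hx]
      rfl
    · rintro rfl
      have hx : ((e.symm x : K) : A × B) = (x, snd (e.symm x)) :=
        Prod.ext (e.apply_symm_apply x) rfl
      exact hx ▸ (e.symm x).2
  exact ⟨snd.comp (e.symm : A →⋆ₙₐ[ℂ] K), mem_iff⟩

end Generated

section JointlyInjective

/-- A family of maps with no common zero except `0`; for a family of homomorphisms this says that
it separates points. -/
def JointlyInjective {A : Type*} [Zero A] {ι : Type*} {W F : ι → Type*} [∀ i, Zero (W i)]
    [∀ i, FunLike (F i) A (W i)] (φ : ∀ i, F i) : Prop :=
  ∀ a, (∀ i, φ i a = 0) → a = 0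

variable {A : Type u} [NonUnitalCStarAlgebra A] {B : Type v} [NonUnitalCStarAlgebra B]
  {ι : Type*} {Z : ι → Type*} [∀ i, NonUnitalCStarAlgebra (Z i)]

theorem JointlyInjective.eq {φ : ∀ i, A →⋆ₙₐ[ℂ] Z i} (hφ : JointlyInjective φ)
    {a b : A} (h : ∀ i, φ i a = φ i b) : a = b :=
  sub_eq_zero.mp <| hφ _ fun i => (map_sub (φ i) a b).trans (sub_eq_zero.mpr (h i))

theorem JointlyInjective.of_injective {φ : A →⋆ₙₐ[ℂ] B} (hφ : Function.Injective φ) :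
    JointlyInjective fun _ : Unit => φ :=
  fun _ ha => (map_eq_zero_iff φ hφ).mp (ha ())

/-- The coordinate projections of the product of a family of C⋆-algebras. -/
def lpEval (Z : ι → Type*) [∀ i, NonUnitalCStarAlgebra (Z i)] (i : ι) : lp Z ∞ →⋆ₙₐ[ℂ] Z i where
  toFun a := a i
  map_smul' _ _ := rfl
  map_zero' := rfl
  map_add' _ _ := rfl
  map_mul' _ _ := rfl
  map_star' _ := rfl

theorem jointlyInjective_lpEval (Z : ι → Type*) [∀ i, NonUnitalCStarAlgebra (Z i)] :
    JointlyInjective (lpEval Z) :=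
  fun _ ha => lp.ext (funext ha)

/-- The `*`-homomorphism into a product of C⋆-algebras given by its coordinates. -/
def lpLift (φ : ∀ i, A →⋆ₙₐ[ℂ] Z i) : A →⋆ₙₐ[ℂ] lp Z ∞ where
  toFun a := ⟨fun i => φ i a, memℓp_infty ⟨‖a‖, by
    rintro _ ⟨i, rfl⟩
    exact NonUnitalStarAlgHom.norm_apply_le (φ i) a⟩⟩
  map_smul' r a := by ext i; exact map_smul (φ i) r a
  map_zero' := by ext i; exact map_zero (φ i)
  map_add' a b := by ext i; exact map_add (φ i) a b
  map_mul' a b := by ext i; exact map_mul (φ i) a b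
  map_star' a := by ext i; exact map_star (φ i) a

theorem JointlyInjective.norm_le {φ : ∀ i, A →⋆ₙₐ[ℂ] Z i} (hφ : JointlyInjective φ)
    {a : A} {M : ℝ} (hM : 0 ≤ M) (h : ∀ i, ‖φ i a‖ ≤ M) : ‖a‖ ≤ M := by
  have hinj : Function.Injective (lpLift φ) := by
    rw [injective_iff_map_eq_zero]
    exact fun x hx => hφ x fun i => congrArg (lpEval Z i) hx
  rw [← NonUnitalStarAlgHom.norm_map (lpLift φ) hinj a]
  exact lp.norm_le_of_forall_le hM h

theorem JointlyInjective.exists_lift {θ : ∀ i, B →⋆ₙₐ[ℂ] Z i}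
    (hθ : JointlyInjective θ) (φ : ∀ i, A →⋆ₙₐ[ℂ] Z i) {s : Set A}
    (hs : cstarGen s = ⊤) (h : ∀ x ∈ s, ∃ y, ∀ i, θ i y = φ i x) :
    ∃ ψ : A →⋆ₙₐ[ℂ] B, ∀ i a, θ i (ψ a) = φ i a := by
  let K : NonUnitalStarSubalgebra ℂ (A × B) :=
    ⨅ i, NonUnitalStarAlgHom.equalizer ((θ i).comp (NonUnitalStarAlgHom.snd ℂ A B))
      ((φ i).comp (NonUnitalStarAlgHom.fst ℂ A B))
  have mem_K : ∀ x y, (x, y) ∈ K ↔ ∀ i, θ i y = φ i x := fun x y => NonUnitalStarAlgebra.mem_iInf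
  have hK : IsClosed (K : Set (A × B)) := by
    rw [NonUnitalStarAlgebra.coe_iInf]
    exact isClosed_iInter fun i => isClosed_eq (map_continuous ((θ i).comp _))
      (map_continuous ((φ i).comp _))
  obtain ⟨ψ, hψ⟩ := exists_hom_of_isClosed_graph K hK
    (fun y hy => hθ y fun i => ((mem_K 0 y).mp hy i).trans (map_zero _)) hs
    fun x hx => (h x hx).imp fun y hy => (mem_K x y).mpr hy
  exact ⟨ψ, fun i a => (mem_K a (ψ a)).mp ((hψ a (ψ a)).mpr rfl) i⟩

/-- The relation `h i x = h' i y` passes from the pairs `(e s, e' s)` to their linear combinations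
and limits, which form a closed `*`-subalgebra of `A × B`. -/
theorem JointlyInjective.exists_hom {S : Type*} [Mul S] [Star S] {e : S → A} {e' : S → B}
    (he_mul : ∀ s t, e s * e t = e (s * t)) (he_star : ∀ s, star (e s) = e (star s))
    (he'_mul : ∀ s t, e' s * e' t = e' (s * t)) (he'_star : ∀ s, star (e' s) = e' (star s))
    (he : cstarGen (Set.range e) = ⊤) {W : ι → Type*} [∀ i, NormedAddCommGroup (W i)]
    [∀ i, NormedSpace ℂ (W i)] {h : ∀ i, A →L[ℂ] W i} {h' : ∀ i, B →L[ℂ] W i}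
    (hh' : JointlyInjective h') (hcomp : ∀ i s, h i (e s) = h' i (e' s)) :
    ∃ φ : A →⋆ₙₐ[ℂ] B, ∀ s, φ (e s) = e' s := by
  let G : NonUnitalStarSubalgebra ℂ (A × B) :=
    NonUnitalStarAlgebra.adjoin ℂ (Set.range fun s => (e s, e' s))
  have hG : ∀ s, (e s, e' s) ∈ G.topologicalClosure := fun s =>
    NonUnitalStarSubalgebra.le_topologicalClosure _
      (NonUnitalStarAlgebra.subset_adjoin ℂ _ ⟨s, rfl⟩)
  have hspan : ∀ z ∈ G, z ∈ Submodule.span ℂ (Set.range fun s => (e s, e' s)) :=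
    fun z hz => mem_span_of_mem_adjoin
      (by
        rintro _ ⟨s, rfl⟩ _ ⟨t, rfl⟩
        exact ⟨s * t, Prod.ext (he_mul s t).symm (he'_mul s t).symm⟩)
      (by rintro _ ⟨s, rfl⟩; exact ⟨star s, Prod.ext (he_star s).symm (he'_star s).symm⟩) hz
  have hcompG : ∀ i, ∀ z ∈ G.topologicalClosure, h i z.1 = h' i z.2 := fun i => by
    have hle : Submodule.span ℂ (Set.range fun s => (e s, e' s)) ≤ LinearMap.eqLocus
        (h i ∘L ContinuousLinearMap.fst ℂ A B).toLinearMap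
        (h' i ∘L ContinuousLinearMap.snd ℂ A B).toLinearMap :=
      Submodule.span_le.mpr (by rintro _ ⟨s, rfl⟩; exact hcomp i s)
    have heq : Set.EqOn (fun z : A × B => h i z.1) (fun z => h' i z.2) G :=
      fun z hz => hle (hspan z hz)
    exact heq.closure (by fun_prop) (by fun_prop)
  obtain ⟨φ, hφ⟩ := exists_hom_of_isClosed_graph G.topologicalClosure
    (NonUnitalStarSubalgebra.isClosed_topologicalClosure _)
    (fun y hy => hh' y fun i => (hcompG i _ hy).symm.trans (map_zero _)) he
    (by rintro _ ⟨s, rfl⟩; exact ⟨e' s, hG s⟩)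
  exact ⟨φ, fun s => (hφ _ _).mp (hG s)⟩

end JointlyInjective

/-! ## Positive functionals separate points -/

section GNS

attribute [local instance] CStarAlgebra.spectralOrder CStarAlgebra.spectralOrderedRing

open scoped ComplexOrder

variable {A : Type u} [NonUnitalCStarAlgebra A]

/-- A real functional separating `-b` from the cone of positive elements, symmetrized under `star`
and then complexified. -/
theorem exists_posFunctional_apply_ne_zero {b : A} (hb : 0 ≤ b) (hb₀ : b ≠ 0) :
    ∃ f : PosFunctional A, f b ≠ 0 := by
  have hnot : -b ∉ ProperCone.positive ℝ A := fun h =>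
    hb₀ (le_antisymm (neg_nonneg.mp h) hb)
  obtain ⟨f, hf, hfb⟩ := ProperCone.hyperplane_separation_point _ hnot
  let g : Module.Dual ℝ A := f.toLinearMap + f.toLinearMap ∘ₗ (starLinearEquiv ℝ).toLinearMap
  have hg : ∀ x, IsSelfAdjoint x → g.extendRCLike x = ((2 * f x : ℝ) : ℂ) := by
    intro x hx
    change ((f x + f (star x) : ℝ) : ℂ) -
      Complex.I * ((f (Complex.I • x) + f (star (Complex.I • x)) : ℝ) : ℂ) = _
    rw [star_smul, hx.star_eq]
    simp [two_mul]
  refine ⟨PositiveLinearMap.mk₀ g.extendRCLike fun x hx => ?_, ?_⟩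
  · rw [hg x (.of_nonneg hx)]
    exact_mod_cast mul_nonneg zero_le_two (hf x hx)
  · change g.extendRCLike b ≠ 0
    rw [hg b (.of_nonneg hb)]
    have hfb' : 0 < f b := by simpa using hfb
    exact_mod_cast (mul_pos two_pos hfb').ne'

theorem jointlyInjective_gnsRep : JointlyInjective (gnsRep (A := A)) := by
  intro a h
  by_contra ha
  have haa : star (a * star a) * (a * star a) ≠ 0 := by
    simpa only [ne_eq, CStarRing.star_mul_self_eq_zero_iff, CStarRing.mul_star_self_eq_zero_iff]
  obtain ⟨f, hf⟩ := exists_posFunctional_apply_ne_zero (star_mul_self_nonneg (a * star a)) haa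
  have happ : gnsRep f a (f.toPreGNS (star a) : f.PreGNS) = 0 :=
    congrArg (· (f.toPreGNS (star a) : f.PreGNS)) (h f)
  rw [PositiveLinearMap.gnsNonUnitalStarAlgHom_apply_coe] at happ
  have hnorm := f.preGNS_norm_sq (f.leftMulMapPreGNS a (f.toPreGNS (star a)))
  rw [← UniformSpace.Completion.norm_coe, happ, norm_zero] at hnorm
  exact hf (by simpa using hnorm.symm)

theorem norm_le_of_norm_inner_gnsRep_le {a : A} {M : ℝ} (hM : 0 ≤ M)
    (h : ∀ (f : PosFunctional A) (x y : GNSSpace f), ‖x‖ = 1 → ‖y‖ = 1 →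
      ‖inner ℂ x (gnsRep f a y)‖ ≤ M) : ‖a‖ ≤ M :=
  jointlyInjective_gnsRep.norm_le hM fun f =>
    ContinuousLinearMap.opNorm_le_of_re_inner_le hM fun y x hy hx => by
      rw [inner_re_symm]
      exact (RCLike.re_le_norm _).trans (h f x y hx hy)

end GNS

/-! ## The minimal tensor product -/

section MinTensor

variable {A : Type u} [NonUnitalCStarAlgebra A] {B : Type v} [NonUnitalCStarAlgebra B]

/-- The product vector `x ⊗ y` in the Hilbert tensor product of two GNS spaces, as a bilinear
map. -/
def gnsTmul (i : PosFunctional A × PosFunctional B) :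
    GNSSpace i.1 →ₗ[ℂ] GNSSpace i.2 →ₗ[ℂ] GNSTensor i :=
  (TensorProduct.mk ℂ (GNSSpace i.1) (GNSSpace i.2)).compr₂
    (UniformSpace.Completion.toComplₗᵢ (𝕜 := ℂ) (E := GNSSpace i.1 ⊗[ℂ] GNSSpace i.2)).toLinearMap

section GNSTensor

variable {i : PosFunctional A × PosFunctional B}

theorem norm_gnsTmul (x : GNSSpace i.1) (y : GNSSpace i.2) : ‖gnsTmul i x y‖ = ‖x‖ * ‖y‖ :=
  (UniformSpace.Completion.norm_coe _).trans (TensorProduct.norm_tmul x y)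

theorem inner_gnsTmul (x x' : GNSSpace i.1) (y y' : GNSSpace i.2) :
    inner ℂ (gnsTmul i x y) (gnsTmul i x' y') = inner ℂ x x' * inner ℂ y y' :=
  (UniformSpace.Completion.inner_coe _ _).trans (TensorProduct.inner_tmul ..)

theorem gnsTensorOp_gnsTmul (a : A) (b : B) (x : GNSSpace i.1) (y : GNSSpace i.2) :
    gnsTensorOp a b i (gnsTmul i x y) = gnsTmul i (gnsRep i.1 a x) (gnsRep i.2 b y) :=
  ContinuousLinearMap.completion_apply_coe _ _

@[elab_as_elim]
theorem gnsTensor_induction {p : GNSTensor i → Prop} (closed : IsClosed {z | p z}) (zero : p 0)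
    (add : ∀ z w, p z → p w → p (z + w)) (tmul : ∀ x y, p (gnsTmul i x y)) (z : GNSTensor i) :
    p z := by
  induction z using UniformSpace.Completion.induction_on with
  | hp => exact closed
  | ih z =>
    induction z with
    | zero => exact zero
    | tmul x y => exact tmul x y
    | add z w hz hw =>
      rw [UniformSpace.Completion.coe_add]
      exact add _ _ hz hw

theorem gnsTensor_clm_ext {E : Type*} [NormedAddCommGroup E] [NormedSpace ℂ E]
    {S T : GNSTensor i →L[ℂ] E} (h : ∀ x y, S (gnsTmul i x y) = T (gnsTmul i x y)) : S = T := by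
  ext z
  induction z using gnsTensor_induction with
  | closed => exact isClosed_eq S.continuous T.continuous
  | zero => rw [map_zero, map_zero]
  | add z w hz hw => rw [map_add, map_add, hz, hw]
  | tmul x y => exact h x y

theorem gnsTensor_eq_of_inner {z w : GNSTensor i}
    (h : ∀ x y, inner ℂ z (gnsTmul i x y) = inner ℂ w (gnsTmul i x y)) : z = w :=
  (InnerProductSpace.toDual ℂ (GNSTensor i)).injective (gnsTensor_clm_ext h)

end GNSTensor

namespace MinTensor

/-- The representation `π_f ⊗ π_g` of the minimal tensor product. -/
def rep (i : PosFunctional A × PosFunctional B) :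
    MinTensor A B →⋆ₙₐ[ℂ] (GNSTensor i →L[ℂ] GNSTensor i) :=
  (lpEval (fun i : PosFunctional A × PosFunctional B => GNSTensor i →L[ℂ] GNSTensor i) i).comp
    (CStarGen.incl (Set.range fun x : A × B => elemTensor x.1 x.2))

@[simp]
theorem rep_minTmul (i : PosFunctional A × PosFunctional B) (a : A) (b : B) :
    rep i (minTmul a b) = gnsTensorOp a b i := rfl

theorem jointlyInjective_rep :
    JointlyInjective (rep (A := A) (B := B)) :=
  fun _ h => CStarGen.incl_injective _ (jointlyInjective_lpEval _ _ h)

theorem ext_rep {x y : MinTensor A B}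
    (h : ∀ (i : PosFunctional A × PosFunctional B) (z : GNSSpace i.1) (w : GNSSpace i.2),
      rep i x (gnsTmul i z w) = rep i y (gnsTmul i z w)) : x = y :=
  jointlyInjective_rep.eq fun i => gnsTensor_clm_ext (h i)

end MinTensor

theorem minTmul_mul_minTmul (a a' : A) (b b' : B) :
    minTmul a b * minTmul a' b' = minTmul (a * a') (b * b') :=
  MinTensor.ext_rep fun i x y => by simp [gnsTensorOp_gnsTmul]

theorem star_minTmul (a : A) (b : B) : star (minTmul a b) = minTmul (star a) (star b) := by
  refine MinTensor.jointlyInjective_rep.eq fun i =>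
    gnsTensor_clm_ext fun x y => gnsTensor_eq_of_inner fun x' y' => ?_
  rw [map_star, MinTensor.rep_minTmul, MinTensor.rep_minTmul,
    ContinuousLinearMap.star_eq_adjoint, ContinuousLinearMap.adjoint_inner_left,
    gnsTensorOp_gnsTmul, gnsTensorOp_gnsTmul, inner_gnsTmul, inner_gnsTmul, map_star, map_star,
    ContinuousLinearMap.star_eq_adjoint, ContinuousLinearMap.star_eq_adjoint,
    ContinuousLinearMap.adjoint_inner_left, ContinuousLinearMap.adjoint_inner_left]

theorem norm_minTmul_le (a : A) (b : B) : ‖minTmul a b‖ ≤ ‖a‖ * ‖b‖ :=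
  lp.norm_le_of_forall_le (by positivity) (norm_gnsTensorOp_le a b)

/-- The elementary tensors `minTmul a b` as a bounded bilinear map. -/
def minTmulL (A : Type u) [NonUnitalCStarAlgebra A] (B : Type v) [NonUnitalCStarAlgebra B] :
    A →L[ℂ] B →L[ℂ] MinTensor A B :=
  LinearMap.mkContinuous₂
    (LinearMap.mk₂ ℂ minTmul
      (fun _ _ _ => MinTensor.ext_rep fun i x y => by simp [gnsTensorOp_gnsTmul])
      (fun _ _ _ => MinTensor.ext_rep fun i x y => by simp [gnsTensorOp_gnsTmul])
      (fun _ _ _ => MinTensor.ext_rep fun i x y => by simp [gnsTensorOp_gnsTmul])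
      (fun _ _ _ => MinTensor.ext_rep fun i x y => by simp [gnsTensorOp_gnsTmul]))
    1 fun a b => by simpa using norm_minTmul_le a b

@[simp]
theorem minTmulL_apply (a : A) (b : B) : minTmulL A B a b = minTmul a b := rfl

theorem cstarGen_range_minTmul :
    cstarGen (Set.range fun x : A × B => minTmul x.1 x.2) = ⊤ :=
  cstarGen_eq_top _ _ (by rintro _ ⟨x, rfl⟩; exact ⟨x, rfl⟩)

/-- A `*`-homomorphism of C⋆-algebras as a bounded linear map. -/
def starHomL (φ : A →⋆ₙₐ[ℂ] B) : A →L[ℂ] B where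
  toLinearMap := φ
  cont := map_continuous φ

@[simp]
theorem starHomL_apply (φ : A →⋆ₙₐ[ℂ] B) (a : A) : starHomL φ a = φ a := rfl

/-- The matrix coefficient `a ↦ ⟪x, π_f(a) y⟫` of the GNS representation of `f`. -/
def gnsCoeff (f : PosFunctional A) (x y : GNSSpace f) : A →L[ℂ] ℂ :=
  innerSL ℂ x ∘L ContinuousLinearMap.apply ℂ (GNSSpace f) y ∘L starHomL (gnsRep f)

@[simp]
theorem gnsCoeff_apply (f : PosFunctional A) (x y : GNSSpace f) (a : A) :
    gnsCoeff f x y a = inner ℂ x (gnsRep f a y) := rfl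

namespace MinTensor

/-- The canonical map from the algebraic to the minimal tensor product. -/
def ofAlg (A : Type u) [NonUnitalCStarAlgebra A] (B : Type v) [NonUnitalCStarAlgebra B] :
    A ⊗[ℂ] B →ₗ[ℂ] MinTensor A B :=
  TensorProduct.lift (ContinuousLinearMap.toLinearMap₁₂ (minTmulL A B))

@[simp]
theorem ofAlg_tmul (a : A) (b : B) : ofAlg A B (a ⊗ₜ b) = minTmul a b := rfl

theorem denseRange_ofAlg : DenseRange (ofAlg A B) := by
  intro z
  have hz : z ∈ cstarGen (Set.range fun x : A × B => minTmul x.1 x.2) :=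
    by rw [cstarGen_range_minTmul]; trivial
  have hle : Submodule.span ℂ (Set.range fun x : A × B => minTmul x.1 x.2) ≤
      LinearMap.range (ofAlg A B) :=
    Submodule.span_le.mpr (by rintro _ ⟨x, rfl⟩; exact ⟨x.1 ⊗ₜ x.2, rfl⟩)
  refine closure_mono (fun y hy => hle (mem_span_of_mem_adjoin ?_ ?_ hy)) hz
  · rintro _ ⟨x, rfl⟩ _ ⟨y, rfl⟩
    exact ⟨x * y, (minTmul_mul_minTmul _ _ _ _).symm⟩
  · rintro _ ⟨x, rfl⟩
    exact ⟨star x, (star_minTmul _ _).symm⟩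

@[elab_as_elim]
theorem induction {p : MinTensor A B → Prop} (closed : IsClosed {z | p z}) (zero : p 0)
    (add : ∀ z w, p z → p w → p (z + w)) (tmul : ∀ a b, p (minTmul a b)) (z : MinTensor A B) :
    p z := by
  refine denseRange_ofAlg.induction_on z closed fun s => ?_
  induction s with
  | zero => exact zero
  | tmul a b => exact tmul a b
  | add s t hs ht =>
    rw [map_add]
    exact add _ _ hs ht

theorem clm_ext {E : Type*} [NormedAddCommGroup E] [NormedSpace ℂ E]
    {S T : MinTensor A B →L[ℂ] E} (h : ∀ a b, S (minTmul a b) = T (minTmul a b)) : S = T := by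
  ext z
  induction z using MinTensor.induction with
  | closed => exact isClosed_eq S.continuous T.continuous
  | zero => rw [map_zero, map_zero]
  | add z w hz hw => rw [map_add, map_add, hz, hw]
  | tmul a b => exact h a b

/-! ## Slice maps -/

/-- The slice map `f ⊗ id` on the algebraic tensor product. -/
def algSliceLeft (f : A →L[ℂ] ℂ) : A ⊗[ℂ] B →ₗ[ℂ] B :=
  (TensorProduct.lid ℂ B).toLinearMap ∘ₗ LinearMap.rTensor B f.toLinearMap

/-- The slice map `id ⊗ g` on the algebraic tensor product. -/
def algSliceRight (g : B →L[ℂ] ℂ) : A ⊗[ℂ] B →ₗ[ℂ] A :=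
  (TensorProduct.rid ℂ A).toLinearMap ∘ₗ LinearMap.lTensor A g.toLinearMap

theorem apply_algSliceLeft (f : A →L[ℂ] ℂ) (g : B →L[ℂ] ℂ) (s : A ⊗[ℂ] B) :
    g (algSliceLeft f s) = f (algSliceRight g s) := by
  have h : g.toLinearMap ∘ₗ algSliceLeft f = f.toLinearMap ∘ₗ algSliceRight g :=
    TensorProduct.ext' fun a b => by simp [algSliceLeft, algSliceRight, mul_comm]
  exact LinearMap.congr_fun h s

theorem gnsCoeff_algSliceLeft_gnsCoeff (i : PosFunctional A × PosFunctional B)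
    (x y : GNSSpace i.1) (x' y' : GNSSpace i.2) (s : A ⊗[ℂ] B) :
    gnsCoeff i.2 x' y' (algSliceLeft (gnsCoeff i.1 x y) s) =
      inner ℂ (gnsTmul i x x') (rep i (ofAlg A B s) (gnsTmul i y y')) := by
  induction s with
  | zero => simp
  | tmul a b =>
    simp [algSliceLeft, gnsTensorOp_gnsTmul, inner_gnsTmul]
  | add s t hs ht => simp only [map_add, hs, ht, add_apply, inner_add_right]

theorem norm_algSliceLeft_gnsCoeff_le (f : PosFunctional A) (x y : GNSSpace f) (s : A ⊗[ℂ] B) :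
    ‖algSliceLeft (gnsCoeff f x y) s‖ ≤ ‖x‖ * ‖y‖ * ‖ofAlg A B s‖ := by
  refine norm_le_of_norm_inner_gnsRep_le (by positivity) fun g x' y' hx' hy' => ?_
  change ‖gnsCoeff (f, g).2 x' y' (algSliceLeft (gnsCoeff (f, g).1 x y) s)‖ ≤ _
  rw [gnsCoeff_algSliceLeft_gnsCoeff]
  calc _ ≤ ‖gnsTmul (f, g) x x'‖ * ‖rep (f, g) (ofAlg A B s) (gnsTmul (f, g) y y')‖ :=
        norm_inner_le_norm _ _
    _ ≤ ‖gnsTmul (f, g) x x'‖ * (‖ofAlg A B s‖ * ‖gnsTmul (f, g) y y'‖) := by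
        gcongr
        exact ContinuousLinearMap.le_of_opNorm_le _ (NonUnitalStarAlgHom.norm_apply_le _ _) _
    _ = ‖x‖ * ‖y‖ * ‖ofAlg A B s‖ := by
        rw [norm_gnsTmul, norm_gnsTmul, hx', hy']
        ring

theorem norm_algSliceRight_le (g : B →L[ℂ] ℂ) (s : A ⊗[ℂ] B) :
    ‖algSliceRight g s‖ ≤ ‖g‖ * ‖ofAlg A B s‖ := by
  refine norm_le_of_norm_inner_gnsRep_le (by positivity) fun f x y hx hy => ?_
  change ‖gnsCoeff f x y (algSliceRight g s)‖ ≤ _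
  rw [← apply_algSliceLeft]
  exact g.le_opNorm_of_le (by simpa [hx, hy] using norm_algSliceLeft_gnsCoeff_le f x y s)

theorem norm_algSliceLeft_le (f : A →L[ℂ] ℂ) (s : A ⊗[ℂ] B) :
    ‖algSliceLeft f s‖ ≤ ‖f‖ * ‖ofAlg A B s‖ := by
  refine NormedSpace.norm_le_dual_bound ℂ _ (by positivity) fun g => ?_
  rw [apply_algSliceLeft, mul_assoc, mul_comm ‖ofAlg A B s‖]
  exact f.le_opNorm_of_le (norm_algSliceRight_le g s)

/-- The slice map `f ⊗ id`. -/
def sliceLeft (f : A →L[ℂ] ℂ) : MinTensor A B →L[ℂ] B :=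
  (algSliceLeft f).extendOfNorm (ofAlg A B)

/-- The slice map `id ⊗ g`. -/
def sliceRight (g : B →L[ℂ] ℂ) : MinTensor A B →L[ℂ] A :=
  (algSliceRight g).extendOfNorm (ofAlg A B)

@[simp]
theorem sliceLeft_minTmul (f : A →L[ℂ] ℂ) (a : A) (b : B) :
    sliceLeft f (minTmul a b) = f a • b :=
  LinearMap.extendOfNorm_eq denseRange_ofAlg ⟨‖f‖, norm_algSliceLeft_le f⟩ (a ⊗ₜ b)

@[simp]
theorem sliceRight_minTmul (g : B →L[ℂ] ℂ) (a : A) (b : B) :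
    sliceRight g (minTmul a b) = g b • a :=
  LinearMap.extendOfNorm_eq denseRange_ofAlg ⟨‖g‖, norm_algSliceRight_le g⟩ (a ⊗ₜ b)

/-- The product functional `f ⊗ g`. -/
def prodFunctional (f : A →L[ℂ] ℂ) (g : B →L[ℂ] ℂ) : MinTensor A B →L[ℂ] ℂ :=
  g ∘L sliceLeft f

@[simp]
theorem prodFunctional_minTmul (f : A →L[ℂ] ℂ) (g : B →L[ℂ] ℂ) (a : A) (b : B) :
    prodFunctional f g (minTmul a b) = f a * g b := by
  simp [prodFunctional]

theorem prodFunctional_eq_comp_sliceRight (f : A →L[ℂ] ℂ) (g : B →L[ℂ] ℂ) :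
    prodFunctional f g = f ∘L sliceRight g :=
  clm_ext fun a b => by simp [mul_comm]

theorem prodFunctional_gnsCoeff (i : PosFunctional A × PosFunctional B) (x y : GNSSpace i.1)
    (x' y' : GNSSpace i.2) (s : MinTensor A B) :
    prodFunctional (gnsCoeff i.1 x y) (gnsCoeff i.2 x' y') s =
      inner ℂ (gnsTmul i x x') (rep i s (gnsTmul i y y')) := by
  have h : prodFunctional (gnsCoeff i.1 x y) (gnsCoeff i.2 x' y') =
      innerSL ℂ (gnsTmul i x x') ∘L
        ContinuousLinearMap.apply ℂ (GNSTensor i) (gnsTmul i y y') ∘L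
          starHomL (rep i) :=
    clm_ext fun a b => by simp [gnsTensorOp_gnsTmul, inner_gnsTmul]
  exact DFunLike.congr_fun h s

theorem jointlyInjective_prodFunctional :
    JointlyInjective fun fg : (A →L[ℂ] ℂ) × (B →L[ℂ] ℂ) => prodFunctional fg.1 fg.2 := by
  refine fun s hs => jointlyInjective_rep s fun i => gnsTensor_clm_ext fun y y' => ?_
  refine gnsTensor_eq_of_inner fun x x' => ?_
  rw [← inner_conj_symm, ← prodFunctional_gnsCoeff, hs (_, _)]
  simp

end MinTensor

theorem jointlyInjective_functionals (E : Type*) [NormedAddCommGroup E] [NormedSpace ℂ E] :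
    JointlyInjective fun f : E →L[ℂ] ℂ => f :=
  fun _ hx => SeparatingDual.eq_zero_of_forall_dual_eq_zero (R := ℂ) hx

theorem JointlyInjective.prodFunctional {ι κ : Type*} {F : ι → A →L[ℂ] ℂ} {G : κ → B →L[ℂ] ℂ}
    (hF : JointlyInjective F) (hG : JointlyInjective G) :
    JointlyInjective fun ij : ι × κ => MinTensor.prodFunctional (F ij.1) (G ij.2) := by
  intro s hs
  refine MinTensor.jointlyInjective_prodFunctional s fun ⟨f, g⟩ => ?_
  change MinTensor.prodFunctional f g s = 0
  have hleft : ∀ i, MinTensor.sliceLeft (F i) s = 0 := fun i => hG _ fun j => hs (i, j)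
  have hright : MinTensor.sliceRight g s = 0 := hF _ fun i => by
    rw [← ContinuousLinearMap.comp_apply, ← MinTensor.prodFunctional_eq_comp_sliceRight]
    exact (congrArg g (hleft i)).trans (map_zero g)
  rw [MinTensor.prodFunctional_eq_comp_sliceRight, ContinuousLinearMap.comp_apply, hright, map_zero]

theorem MinTensor.exists_hom {E : Type w} [NonUnitalCStarAlgebra E] (t : A × B → E)
    (ht_mul : ∀ x y, t x * t y = t (x * y)) (ht_star : ∀ x, star (t x) = t (star x))
    {ι : Type*} (F : ι → A →L[ℂ] ℂ) (G : ι → B →L[ℂ] ℂ) {H : ι → E →L[ℂ] ℂ}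
    (hH : JointlyInjective H) (hcomp : ∀ i x, F i x.1 * G i x.2 = H i (t x)) :
    ∃ φ : MinTensor A B →⋆ₙₐ[ℂ] E, ∀ a b, φ (minTmul a b) = t (a, b) := by
  obtain ⟨φ, hφ⟩ := hH.exists_hom (h := fun i => prodFunctional (F i) (G i))
    (e := fun x : A × B => minTmul x.1 x.2) (e' := t) (fun _ _ => minTmul_mul_minTmul ..)
    (fun _ => star_minTmul _ _) ht_mul ht_star cstarGen_range_minTmul
    fun i x => (prodFunctional_minTmul _ _ _ _).trans (hcomp i x)
  exact ⟨φ, fun a b => hφ (a, b)⟩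

theorem MinTensor.exists_map {A' B' : Type*} [NonUnitalCStarAlgebra A']
    [NonUnitalCStarAlgebra B'] (φ : A →⋆ₙₐ[ℂ] A') (ψ : B →⋆ₙₐ[ℂ] B') :
    ∃ θ : MinTensor A B →⋆ₙₐ[ℂ] MinTensor A' B',
      ∀ a b, θ (minTmul a b) = minTmul (φ a) (ψ b) :=
  MinTensor.exists_hom (fun x => minTmul (φ x.1) (ψ x.2)) (by simp [minTmul_mul_minTmul])
    (by simp [star_minTmul, map_star]) (fun fg => fg.1 ∘L starHomL φ)
    (fun fg => fg.2 ∘L starHomL ψ) jointlyInjective_prodFunctional (by simp)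

theorem MinTensor.exists_slice (ε : B →⋆ₙₐ[ℂ] ℂ) :
    ∃ θ : MinTensor A B →⋆ₙₐ[ℂ] A, ∀ a b, θ (minTmul a b) = ε b • a :=
  MinTensor.exists_hom (fun x => ε x.2 • x.1) (by simp [smul_mul_smul_comm])
    (by simp [map_star]) (fun f => f) (fun _ => starHomL ε) (jointlyInjective_functionals A)
    (by simp [mul_comm])

theorem cstarGen_range_minTmul_minTmul (A B C : Type*) [NonUnitalCStarAlgebra A]
    [NonUnitalCStarAlgebra B] [NonUnitalCStarAlgebra C] :
    cstarGen (Set.range fun x : A × B × C => minTmul (minTmul x.1 x.2.1) x.2.2) = ⊤ := by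
  rw [eq_top_iff, ← cstarGen_range_minTmul]
  refine cstarGen_le (cstarGen_isClosed _) ?_
  rintro _ ⟨⟨z, c⟩, rfl⟩
  change (minTmulL (MinTensor A B) C).flip c z ∈ cstarGen _
  induction z using MinTensor.induction with
  | closed => exact (cstarGen_isClosed _).preimage (ContinuousLinearMap.continuous _)
  | zero => exact (map_zero ((minTmulL (MinTensor A B) C).flip c)).symm ▸ zero_mem _
  | add z w hz hw => exact (map_add ((minTmulL (MinTensor A B) C).flip c) z w).symm ▸ add_mem hz hw
  | tmul a b => exact mem_cstarGen ⟨(a, b, c), rfl⟩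

theorem MinTensor.exists_assoc (A B C : Type*) [NonUnitalCStarAlgebra A]
    [NonUnitalCStarAlgebra B] [NonUnitalCStarAlgebra C] :
    ∃ θ : MinTensor (MinTensor A B) C →⋆ₙₐ[ℂ] MinTensor A (MinTensor B C),
      ∀ a b c, θ (minTmul (minTmul a b) c) = minTmul a (minTmul b c) := by
  have hinj := (jointlyInjective_functionals A).prodFunctional
    (jointlyInjective_prodFunctional (A := B) (B := C))
  obtain ⟨φ, hφ⟩ := hinj.exists_hom
    (h := fun i => prodFunctional (prodFunctional i.1 i.2.1) i.2.2)
    (e := fun x : A × B × C => minTmul (minTmul x.1 x.2.1) x.2.2)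
    (e' := fun x => minTmul x.1 (minTmul x.2.1 x.2.2))
    (by simp [minTmul_mul_minTmul]) (by simp [star_minTmul]) (by simp [minTmul_mul_minTmul])
    (by simp [star_minTmul]) (cstarGen_range_minTmul_minTmul A B C) (by simp [mul_assoc])
  exact ⟨φ, fun a b c => hφ (a, b, c)⟩

/-- The functionals factoring through some `φ i` separate the points of `A`, similarly for `ψ`, and
the products of such functionals factor through some `θ ij`. -/
theorem JointlyInjective.minTensor {ι κ : Type*} {Z : ι → Type*} {W : κ → Type*}
    [∀ i, NonUnitalCStarAlgebra (Z i)] [∀ j, NonUnitalCStarAlgebra (W j)]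
    {φ : ∀ i, A →⋆ₙₐ[ℂ] Z i} {ψ : ∀ j, B →⋆ₙₐ[ℂ] W j} (hφ : JointlyInjective φ)
    (hψ : JointlyInjective ψ) {θ : ∀ ij : ι × κ, MinTensor A B →⋆ₙₐ[ℂ] MinTensor (Z ij.1) (W ij.2)}
    (hθ : ∀ ij a b, θ ij (minTmul a b) = minTmul (φ ij.1 a) (ψ ij.2 b)) : JointlyInjective θ := by
  have hF : JointlyInjective fun f : Σ i, Z i →L[ℂ] ℂ => f.2 ∘L starHomL (φ f.1) := fun a ha =>
    hφ a fun i => jointlyInjective_functionals _ _ fun f => ha ⟨i, f⟩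
  have hG : JointlyInjective fun g : Σ j, W j →L[ℂ] ℂ => g.2 ∘L starHomL (ψ g.1) := fun b hb =>
    hψ b fun j => jointlyInjective_functionals _ _ fun g => hb ⟨j, g⟩
  refine fun s hs => hF.prodFunctional hG s fun ⟨⟨i, f⟩, ⟨j, g⟩⟩ => ?_
  have hfactor : MinTensor.prodFunctional (f ∘L starHomL (φ i)) (g ∘L starHomL (ψ j)) =
      MinTensor.prodFunctional f g ∘L starHomL (θ (i, j)) :=
    MinTensor.clm_ext fun a b => by simp [hθ]
  exact (DFunLike.congr_fun hfactor s).trans (by simp [hs])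

theorem IsUnitElement.minTmul {e : A} {e' : B} (h : IsUnitElement e) (h' : IsUnitElement e') :
    IsUnitElement (minTmul e e') := by
  intro z
  induction z using MinTensor.induction with
  | closed =>
    exact (isClosed_eq (continuous_const_mul _) continuous_id).inter
      (isClosed_eq (continuous_mul_const _) continuous_id)
  | zero => simp
  | add z w hz hw => rw [mul_add, add_mul, hz.1, hz.2, hw.1, hw.2]; exact ⟨rfl, rfl⟩
  | tmul a b =>
    rw [minTmul_mul_minTmul, minTmul_mul_minTmul, (h a).1, (h a).2, (h' b).1, (h' b).2]
    exact ⟨rfl, rfl⟩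

end MinTensor

/-! ## Homomorphisms of pairs -/

namespace MatPair

variable {N : ℕ}

/-- There is a `*`-homomorphism mapping the matrix of `X` entrywise to the matrix of `Y`. -/
def Maps (X : MatPair.{u} N) (Y : MatPair.{v} N) : Prop :=
  ∃ φ : X.carrier →⋆ₙₐ[ℂ] Y.carrier, ∀ i j, φ (X.mat i j) = Y.mat i j

/-- There is a counit: a `*`-homomorphism to `ℂ` mapping the matrix to the identity matrix. -/
def HasCounit (X : MatPair.{u} N) : Prop :=
  ∃ ε : X.carrier →⋆ₙₐ[ℂ] ℂ, ∀ i j, ε (X.mat i j) = (1 : Matrix (Fin N) (Fin N) ℂ) i j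

section Maps

variable {X : MatPair.{u} N} {Y : MatPair.{v} N} {Z : MatPair.{w} N}

theorem Maps.refl (X : MatPair.{u} N) : Maps X X := ⟨NonUnitalStarAlgHom.id ℂ _, fun _ _ => rfl⟩

theorem Maps.trans (h : Maps X Y) (h' : Maps Y Z) : Maps X Z := by
  obtain ⟨φ, hφ⟩ := h
  obtain ⟨ψ, hψ⟩ := h'
  exact ⟨ψ.comp φ, fun i j => (congrArg ψ (hφ i j)).trans (hψ i j)⟩

theorem HasCounit.of_maps (hY : Y.HasCounit) (h : Maps X Y) : X.HasCounit := by
  obtain ⟨ε, hε⟩ := hY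
  obtain ⟨φ, hφ⟩ := h
  exact ⟨ε.comp φ, fun i j => (congrArg ε (hφ i j)).trans (hε i j)⟩

theorem Maps.wprod {X' Y' : MatPair N} (h : Maps X X') (h' : Maps Y Y') :
    Maps (X.wprod Y) (X'.wprod Y') := by
  obtain ⟨φ, hφ⟩ := h
  obtain ⟨ψ, hψ⟩ := h'
  obtain ⟨θ, hθ⟩ := MinTensor.exists_map φ ψ
  refine ⟨θ, fun i j => ?_⟩
  change θ (∑ k, minTmul (X.mat i k) (Y.mat k j)) = ∑ k, minTmul (X'.mat i k) (Y'.mat k j)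
  simp only [map_sum, hθ, hφ, hψ]

theorem maps_wprod_assoc (X : MatPair.{u} N) (Y : MatPair.{v} N) (Z : MatPair.{w} N) :
    Maps ((X.wprod Y).wprod Z) (X.wprod (Y.wprod Z)) := by
  obtain ⟨θ, hθ⟩ := MinTensor.exists_assoc X.carrier Y.carrier Z.carrier
  refine ⟨θ, fun i j => ?_⟩
  change θ (∑ k, minTmulL _ _ (∑ l, minTmul (X.mat i l) (Y.mat l k)) (Z.mat k j)) =
    ∑ l, minTmulL _ _ (X.mat i l) (∑ k, minTmul (Y.mat l k) (Z.mat k j))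
  simp only [map_sum, sum_apply, minTmulL_apply, hθ]
  exact Finset.sum_comm

theorem HasCounit.maps_wprod_left (hY : Y.HasCounit) (X : MatPair.{u} N) :
    Maps (X.wprod Y) X := by
  obtain ⟨ε, hε⟩ := hY
  obtain ⟨θ, hθ⟩ := MinTensor.exists_slice (A := X.carrier) ε
  refine ⟨θ, fun i j => ?_⟩
  change θ (∑ k, minTmul (X.mat i k) (Y.mat k j)) = X.mat i j
  simp [hθ, hε, Matrix.one_apply]

theorem HasCounit.wprod (hX : X.HasCounit) (hY : Y.HasCounit) : (X.wprod Y).HasCounit :=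
  hX.of_maps (hY.maps_wprod_left X)

end Maps

theorem wprodList_induction {p : MatPair.{u} N → Prop} (hp : ∀ X Y, p X → p Y → p (X.wprod Y))
    {X : MatPair.{u} N} {l : List (MatPair.{u} N)} (hX : p X) (hl : ∀ Y ∈ l, p Y) :
    p (X.wprodList l) :=
  List.foldlRecOn l MatPair.wprod hX fun Y hY Z hZ => hp Y Z hY (hl Z hZ)

theorem wpow_induction {p : MatPair.{u} N → Prop} (hp : ∀ X Y, p X → p Y → p (X.wprod Y))
    {X : MatPair.{u} N} (hX : p X) (n : ℕ+) : p (X.wpow n) :=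
  wprodList_induction hp hX fun _ hY => List.eq_of_mem_replicate hY ▸ hX

theorem wpow_one (X : MatPair.{u} N) : X.wpow 1 = X := rfl

theorem wpow_add_one (X : MatPair.{u} N) (n : ℕ+) : X.wpow (n + 1) = (X.wpow n).wprod X := by
  have hn : (n + 1).natPred = n.natPred + 1 := n.natPred_add_one.symm
  simp only [wpow, wprodList, hn, List.replicate_succ', List.foldl_append, List.foldl_cons,
    List.foldl_nil]

theorem maps_wpow_add (X : MatPair.{u} N) (n m : ℕ+) :
    Maps (X.wpow (n + m)) ((X.wpow n).wprod (X.wpow m)) := by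
  induction m with
  | one =>
    rw [wpow_add_one, wpow_one]
    exact Maps.refl _
  | succ m ih =>
    rw [← add_assoc, wpow_add_one, wpow_add_one]
    exact (ih.wprod (Maps.refl X)).trans (maps_wprod_assoc _ _ _)

theorem Maps.wpow_wprod_wpow {X : MatPair.{u} N} {Y : MatPair.{v} N}
    (h : ∀ n : ℕ, Maps X (Y.wpow n.succPNat)) (n m : ℕ) :
    Maps X ((Y.wpow n.succPNat).wprod (Y.wpow m.succPNat)) := by
  have hnm : (n + m + 1).succPNat = n.succPNat + m.succPNat :=
    PNat.eq (by simp only [Nat.succPNat_coe, PNat.add_coe]; lia)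
  exact (hnm ▸ h (n + m + 1)).trans (Y.maps_wpow_add _ _)

/-- The inclusion of the C⋆-algebra generated by the entries of the matrix. -/
def generatedIncl (X : MatPair.{u} N) : X.generatedObj.carrier →⋆ₙₐ[ℂ] X.carrier :=
  CStarGen.incl X.entries

theorem generatedIncl_mat (X : MatPair.{u} N) (i j : Fin N) :
    X.generatedIncl (X.generatedObj.mat i j) = X.mat i j := rfl

theorem generatedIncl_injective (X : MatPair.{u} N) : Function.Injective X.generatedIncl :=
  CStarGen.incl_injective _

theorem maps_generatedObj (X : MatPair.{u} N) : Maps X.generatedObj.toMatPair X :=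
  ⟨X.generatedIncl, X.generatedIncl_mat⟩

end MatPair

namespace CatObj

variable {N : ℕ}

theorem hom_ext (X : CatObj.{u} N) {B : Type v} [NonUnitalCStarAlgebra B]
    {φ ψ : X.carrier →⋆ₙₐ[ℂ] B} (h : ∀ i j, φ (X.mat i j) = ψ (X.mat i j)) : φ = ψ :=
  hom_ext_of_cstarGen_eq_top X.generated (by rintro _ ⟨ij, rfl⟩; exact h ij.1 ij.2)

/-- A homomorphism of pairs, restricted to the algebra generated by the entries of the target. -/
def arrowOfHom (X : CatObj.{u} N) (Y : MatPair.{v} N) (φ : X.carrier →⋆ₙₐ[ℂ] Y.carrier)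
    (hφ : ∀ i j, φ (X.mat i j) = Y.mat i j) : CatArrow X Y.generatedObj where
  hom := NonUnitalStarAlgHom.codRestrict φ (cstarGen Y.entries) <|
    map_mem_cstarGen X.generated φ <| by
      rintro _ ⟨⟨i, j⟩, rfl⟩
      exact mem_cstarGen ⟨(i, j), (hφ i j).symm⟩
  map_mat i j := Subtype.ext (hφ i j)

end CatObj

theorem MatPair.Maps.nonempty_catArrow {N : ℕ} {X : MatPair.{u} N} {Y : MatPair.{v} N}
    (h : Maps X Y) : Nonempty (CatArrow X.generatedObj Y.generatedObj) := by
  obtain ⟨φ, hφ⟩ := X.maps_generatedObj.trans h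
  exact ⟨X.generatedObj.arrowOfHom Y φ hφ⟩

/-! ## Unitary matrices over C⋆-algebras -/

section IsUnitElement

variable {A : Type u} [NonUnitalCStarAlgebra A] {e e' : A}

theorem IsUnitElement.eq (h : IsUnitElement e) (h' : IsUnitElement e') : e = e' :=
  (h' e).1.symm.trans (h e').2

theorem IsUnitElement.star (h : IsUnitElement e) : IsUnitElement (star e) := fun a =>
  ⟨by rw [← star_inj, star_mul, star_star, (h _).2],
    by rw [← star_inj, star_mul, star_star, (h _).1]⟩

theorem IsUnitElement.isStarProjection (h : IsUnitElement e) : IsStarProjection e :=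
  ⟨(h e).1, h.star.eq h⟩

theorem isUnitElement_of_cstarGen_eq_top {s : Set A} (hs : cstarGen s = ⊤) (he : IsSelfAdjoint e)
    (h : ∀ x ∈ s, e * x = x ∧ x * e = x) : IsUnitElement e := by
  let S : NonUnitalStarSubalgebra ℂ A :=
    { carrier := {a | e * a = a ∧ a * e = a}
      add_mem' := fun {a b} ha hb => ⟨by rw [mul_add, ha.1, hb.1], by rw [add_mul, ha.2, hb.2]⟩
      zero_mem' := ⟨mul_zero _, zero_mul _⟩
      mul_mem' := fun {a b} ha hb => ⟨by rw [← mul_assoc, ha.1], by rw [mul_assoc, hb.2]⟩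
      smul_mem' := fun r a ha => ⟨by rw [mul_smul_comm, ha.1], by rw [smul_mul_assoc, ha.2]⟩
      star_mem' := fun {a} ha => ⟨by rw [← he.star_eq, ← star_mul, ha.2],
        by rw [← he.star_eq, ← star_mul, ha.1]⟩ }
  have hS : IsClosed (S : Set A) :=
    (isClosed_eq (continuous_const_mul e) continuous_id).inter
      (isClosed_eq (continuous_mul_const e) continuous_id)
  exact mem_of_cstarGen_eq_top hs hS h

end IsUnitElement

section IsUnitaryMatrix

variable {n : Type*} [Fintype n] {A : Type u} [NonUnitalCStarAlgebra A]
  {B : Type v} [NonUnitalCStarAlgebra B]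

/-- The Woronowicz product of two matrices, with entries `∑ k, x_ik ⊗ y_kj`. -/
def wmul (x : Matrix n n A) (y : Matrix n n B) : Matrix n n (MinTensor A B) :=
  Matrix.of fun i j => ∑ k, minTmul (x i k) (y k j)

theorem wmul_map_star (x : Matrix n n A) (y : Matrix n n B) :
    (wmul x y).map star = wmul (x.map star) (y.map star) := by
  ext i j
  simp [wmul, star_sum, star_minTmul]

theorem minTmul_ite_zero (p : Prop) [Decidable p] (a : A) (b : B) :
    minTmul a (if p then b else 0) = if p then minTmul a b else 0 := by
  rw [apply_ite (minTmul a), ← minTmulL_apply a 0, map_zero]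

theorem ite_zero_minTmul (p : Prop) [Decidable p] (a : A) (b : B) :
    minTmul (if p then a else 0) b = if p then minTmul a b else 0 := by
  rw [apply_ite fun z => minTmul z b, ← minTmulL_apply 0 b, map_zero, zero_apply]

theorem minTmul_sum (a : A) (b : n → B) : minTmul a (∑ k, b k) = ∑ k, minTmul a (b k) :=
  map_sum (minTmulL A B a) b _

theorem sum_minTmul (a : n → A) (b : B) : minTmul (∑ k, a k) b = ∑ k, minTmul (a k) b :=
  map_sum ((minTmulL A B).flip b) a _

variable [DecidableEq n]

/-- The matrix `x` over `A` is unitary, where `e` stands for the unit of `A`. -/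
structure IsUnitaryMatrix (x : Matrix n n A) (e : A) : Prop where
  mul_conjTranspose : x * xᴴ = Matrix.diagonal fun _ => e
  conjTranspose_mul : xᴴ * x = Matrix.diagonal fun _ => e

namespace IsUnitaryMatrix

variable {x : Matrix n n A} {e : A}

theorem sum_mul_star (h : IsUnitaryMatrix x e) (i j : n) :
    ∑ k, x i k * star (x j k) = if i = j then e else 0 :=
  congrFun₂ h.mul_conjTranspose i j

theorem sum_star_mul (h : IsUnitaryMatrix x e) (i j : n) :
    ∑ k, star (x k i) * x k j = if i = j then e else 0 :=
  congrFun₂ h.conjTranspose_mul i j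

theorem of_isHermitian (hx : x.IsHermitian) (h : x * x = Matrix.diagonal fun _ => e) :
    IsUnitaryMatrix x e :=
  ⟨by rw [hx.eq, h], by rw [hx.eq, h]⟩

theorem map (h : IsUnitaryMatrix x e) (φ : A →⋆ₙₐ[ℂ] B) : IsUnitaryMatrix (x.map φ) (φ e) := by
  have hstar : (x.map φ)ᴴ = xᴴ.map φ := (Matrix.conjTranspose_map φ (map_star φ)).symm
  have hdiag : (Matrix.diagonal fun _ : n => φ e) = (Matrix.diagonal fun _ => e).map φ :=
    (Matrix.diagonal_map (map_zero φ)).symm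
  refine ⟨?_, ?_⟩
  · rw [hstar, hdiag, ← Matrix.map_mul, h.mul_conjTranspose]
  · rw [hstar, hdiag, ← Matrix.map_mul, h.conjTranspose_mul]

theorem eq_unit [Nonempty n] (h : IsUnitaryMatrix x e) {e' : A} (h' : IsUnitaryMatrix x e') :
    e = e' := by
  have i : n := Classical.arbitrary n
  simpa using congrFun₂ (h.mul_conjTranspose.symm.trans h'.mul_conjTranspose) i i

theorem of_jointlyInjective {ι : Type*} {Z : ι → Type*} [∀ i, NonUnitalCStarAlgebra (Z i)]
    {φ : ∀ i, A →⋆ₙₐ[ℂ] Z i} (hφ : JointlyInjective φ)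
    (h : ∀ i, IsUnitaryMatrix (x.map (φ i)) (φ i e)) : IsUnitaryMatrix x e := by
  refine ⟨Matrix.ext fun j k => hφ.eq fun i => ?_, Matrix.ext fun j k => hφ.eq fun i => ?_⟩
  · simpa [Matrix.mul_apply, Matrix.diagonal_apply, apply_ite, map_star]
      using (h i).sum_mul_star j k
  · simpa [Matrix.mul_apply, Matrix.diagonal_apply, apply_ite, map_star]
      using (h i).sum_star_mul j k

attribute [local instance] CStarAlgebra.spectralOrder CStarAlgebra.spectralOrderedRing in
theorem norm_apply_le (h : IsUnitaryMatrix x e) (he : IsUnitElement e) (i j : n) :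
    ‖x i j‖ ≤ 1 := by
  have hle : x i j * star (x i j) ≤ e := by
    have hsum := h.sum_mul_star i i
    rw [if_pos rfl] at hsum
    exact hsum ▸ Finset.single_le_sum (f := fun k => x i k * star (x i k))
      (fun k _ => mul_star_self_nonneg _) (Finset.mem_univ j)
  have hnorm : ‖x i j‖ * ‖x i j‖ ≤ 1 := by
    rw [← CStarRing.norm_self_mul_star]
    exact (CStarAlgebra.norm_le_norm_of_nonneg_of_le (mul_star_self_nonneg _) hle).trans
      he.isStarProjection.norm_le
  nlinarith [norm_nonneg (x i j)]

end IsUnitaryMatrix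

theorem IsUnitaryMatrix.wmul {x : Matrix n n A} {y : Matrix n n B} {e : A} {e' : B}
    (hx : IsUnitaryMatrix x e) (hy : IsUnitaryMatrix y e') :
    IsUnitaryMatrix (wmul x y) (minTmul e e') := by
  refine ⟨Matrix.ext fun i j => ?_, Matrix.ext fun i j => ?_⟩
  · calc ∑ k, (∑ a, minTmul (x i a) (y a k)) * star (∑ b, minTmul (x j b) (y b k))
        = ∑ a, ∑ b, minTmul (x i a * star (x j b)) (∑ k, y a k * star (y b k)) := by
          simp only [star_sum, star_minTmul, Finset.sum_mul_sum, minTmul_mul_minTmul, minTmul_sum]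
          rw [Finset.sum_comm]
          exact Finset.sum_congr rfl fun a _ => Finset.sum_comm
      _ = minTmul (∑ a, x i a * star (x j a)) e' := by
          simp [hy.sum_mul_star, minTmul_ite_zero, sum_minTmul]
      _ = Matrix.diagonal (fun _ => minTmul e e') i j := by
          rw [hx.sum_mul_star, ite_zero_minTmul, Matrix.diagonal_apply]
  · calc ∑ k, star (∑ a, minTmul (x k a) (y a i)) * ∑ b, minTmul (x k b) (y b j)
        = ∑ a, ∑ b, minTmul (∑ k, star (x k a) * x k b) (star (y a i) * y b j) := by
          simp only [star_sum, star_minTmul, Finset.sum_mul_sum, minTmul_mul_minTmul, sum_minTmul]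
          rw [Finset.sum_comm]
          exact Finset.sum_congr rfl fun a _ => Finset.sum_comm
      _ = minTmul e (∑ a, star (y a i) * y a j) := by
          simp [hx.sum_star_mul, ite_zero_minTmul, minTmul_sum]
      _ = Matrix.diagonal (fun _ => minTmul e e') i j := by
          rw [hy.sum_star_mul, minTmul_ite_zero, Matrix.diagonal_apply]

end IsUnitaryMatrix

namespace MatPair

variable {N : ℕ}

/-- The matrix of `X` and its entrywise adjoint are unitary. -/
def IsBiunitary (X : MatPair.{u} N) : Prop :=
  ∃ e, IsUnitElement e ∧ IsUnitaryMatrix X.mat e ∧ IsUnitaryMatrix (X.mat.map star) e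

namespace IsBiunitary

theorem wprod {X : MatPair.{u} N} {Y : MatPair.{v} N} (hX : X.IsBiunitary)
    (hY : Y.IsBiunitary) : (X.wprod Y).IsBiunitary := by
  obtain ⟨e, he, hu, hu'⟩ := hX
  obtain ⟨e', he', hv, hv'⟩ := hY
  refine ⟨minTmul e e', he.minTmul he', hu.wmul hv, ?_⟩
  have hmap : (X.wprod Y).mat.map star = wmul (X.mat.map star) (Y.mat.map star) :=
    wmul_map_star X.mat Y.mat
  rw [hmap]
  exact hu'.wmul hv'

theorem of_jointlyInjective [NeZero N] {X : MatPair.{u} N} {ι : Type*} {Z : ι → MatPair.{v} N}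
    {φ : ∀ i, X.carrier →⋆ₙₐ[ℂ] (Z i).carrier} (hφ : JointlyInjective φ)
    (hmat : ∀ i j k, φ i (X.mat j k) = (Z i).mat j k) (hZ : ∀ i, (Z i).IsBiunitary) :
    X.IsBiunitary := by
  choose e he hu hu' using hZ
  have hmap : ∀ i, X.mat.map (φ i) = (Z i).mat := fun i => Matrix.ext (hmat i)
  have hmap_star : ∀ i, (X.mat.map star).map (φ i) = (Z i).mat.map star := fun i =>
    Matrix.ext fun j k => (map_star (φ i) _).trans (congrArg star (hmat i j k))
  have hunit : ∀ i, φ i (∑ k, X.mat 0 k * star (X.mat 0 k)) = e i := fun i => by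
    simpa [hmat, map_star] using (hu i).sum_mul_star 0 0
  refine ⟨∑ k, X.mat 0 k * star (X.mat 0 k), fun a => ⟨hφ.eq fun i => ?_, hφ.eq fun i => ?_⟩,
    .of_jointlyInjective hφ fun i => ?_, .of_jointlyInjective hφ fun i => ?_⟩
  · rw [map_mul, hunit, (he i _).1]
  · rw [map_mul, hunit, (he i _).2]
  · rw [hmap, hunit]
    exact hu i
  · rw [hmap_star, hunit]
    exact hu' i

theorem generatedObj [NeZero N] {X : MatPair.{u} N} (hX : X.IsBiunitary) :
    X.generatedObj.toMatPair.IsBiunitary :=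
  of_jointlyInjective (.of_injective X.generatedIncl_injective)
    (fun _ => X.generatedIncl_mat) fun _ => hX

theorem norm_mat_le {X : MatPair.{u} N} (hX : X.IsBiunitary) (i j : Fin N) :
    ‖X.mat i j‖ ≤ 1 := by
  obtain ⟨e, he, hu, -⟩ := hX
  exact hu.norm_apply_le he i j

end IsBiunitary

end MatPair

/-! ## Inverse limits -/

section Limit

variable {N : ℕ} {D : ℕ → CatObj.{u} N} {π : ∀ n, CatArrow (D (n + 1)) (D n)}

/-- The matrix of sequences of entries, in the product of the C⋆-algebras; the bound makes its
entries elements of that product. -/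
def seqPair (D : ℕ → CatObj.{u} N)
    (hD : ∀ i j, BddAbove (Set.range fun n => ‖(D n).mat i j‖)) : MatPair.{u} N where
  carrier := lp (fun n => (D n).carrier) ∞
  mat i j := ⟨fun n => (D n).mat i j, memℓp_infty (hD i j)⟩

/-- The cone whose point is generated by the sequences of entries. -/
def limitCone (hD : ∀ i j, BddAbove (Set.range fun n => ‖(D n).mat i j‖))
    (π : ∀ n, CatArrow (D (n + 1)) (D n)) : CatCone π where
  pt := (seqPair D hD).generatedObj
  arrow n :=
    { hom := (lpEval (fun n => (D n).carrier) n).comp (seqPair D hD).generatedIncl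
      map_mat := fun _ _ => rfl }
  comm n a := by
    have hcomp : (π n).hom.comp ((lpEval (fun n => (D n).carrier) (n + 1)).comp
          (seqPair D hD).generatedIncl) =
        (lpEval (fun n => (D n).carrier) n).comp (seqPair D hD).generatedIncl :=
      CatObj.hom_ext _ fun i j => (π n).map_mat i j
    exact DFunLike.congr_fun hcomp a

theorem limitCone_isInverseLimit (hD : ∀ i j, BddAbove (Set.range fun n => ‖(D n).mat i j‖))
    (π : ∀ n, CatArrow (D (n + 1)) (D n)) : (limitCone hD π).IsInverseLimit := fun C =>
  ⟨C.pt.arrowOfHom (seqPair D hD) (lpLift fun n => (C.arrow n).hom) fun i j =>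
    lp.ext (funext fun n => (C.arrow n).map_mat i j), fun _ _ => rfl⟩

theorem CatCone.bddAbove_norm_mat (C : CatCone π) (i j : Fin N) :
    BddAbove (Set.range fun n => ‖(D n).mat i j‖) := by
  refine ⟨‖C.pt.mat i j‖, ?_⟩
  rintro _ ⟨n, rfl⟩
  simp only [← (C.arrow n).map_mat]
  exact NonUnitalStarAlgHom.norm_apply_le _ _

theorem CatCone.IsInverseLimit.jointlyInjective {C : CatCone π} (hC : C.IsInverseLimit) :
    JointlyInjective fun n => (C.arrow n).hom := by
  intro a ha
  have hD := C.bddAbove_norm_mat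
  obtain ⟨ψ, -⟩ := hC (limitCone hD π)
  obtain ⟨ψ', hψ'⟩ := limitCone_isInverseLimit hD π C
  have hzero : ψ'.hom a = 0 :=
    (seqPair D hD).generatedIncl_injective <|
      jointlyInjective_lpEval _ _ fun n => (hψ' n a).trans (ha n)
  have hid : ψ.hom.comp ψ'.hom = NonUnitalStarAlgHom.id ℂ C.pt.carrier :=
    CatObj.hom_ext _ fun i j => (congrArg ψ.hom (ψ'.map_mat i j)).trans (ψ.map_mat i j)
  calc a = ψ.hom (ψ'.hom a) := (DFunLike.congr_fun hid a).symm
    _ = 0 := by rw [hzero, map_zero]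

end Limit

/-! ## Comultiplications -/

section Comultiplication

variable {N : ℕ} {X : CatObj.{u} N}

/-- The maps `r i ⊗ r j` are jointly injective, so the homomorphisms to `Z i ⊗ Z j` lift through
them. -/
theorem CatObj.maps_wprod_self {ι : Type*} {Z : ι → MatPair.{v} N}
    {r : ∀ i, X.carrier →⋆ₙₐ[ℂ] (Z i).carrier} (hr : JointlyInjective r)
    (hmat : ∀ i j k, r i (X.mat j k) = (Z i).mat j k)
    (hZ : ∀ i j, X.toMatPair.Maps ((Z i).wprod (Z j))) :
    X.toMatPair.Maps (X.toMatPair.wprod X.toMatPair) := by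
  choose s hs using hZ
  choose θ hθ using fun ij : ι × ι => MinTensor.exists_map (r ij.1) (r ij.2)
  have hθ_mat : ∀ ij i j, θ ij ((X.toMatPair.wprod X.toMatPair).mat i j) =
      s ij.1 ij.2 (X.mat i j) := by
    intro ij i j
    change θ ij (∑ k, minTmul (X.mat i k) (X.mat k j)) = _
    simp only [map_sum, hθ, hmat, hs]
    rfl
  have hinj : JointlyInjective θ := hr.minTensor hr hθ
  obtain ⟨Δ, hΔ⟩ := hinj.exists_lift (fun ij => s ij.1 ij.2) X.generated <| by
    rintro _ ⟨⟨i, j⟩, rfl⟩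
    exact ⟨_, fun ij => hθ_mat ij i j⟩
  exact ⟨Δ, fun i j => hinj.eq fun ij => (hΔ ij _).trans (hθ_mat ij i j).symm⟩

theorem MatPair.IsBiunitary.isComultiplication [NeZero N] (hX : X.toMatPair.IsBiunitary)
    {Δ : X.carrier →⋆ₙₐ[ℂ] MinTensor X.carrier X.carrier}
    (hΔ : ∀ i j, Δ (X.mat i j) = ∑ k, minTmul (X.mat i k) (X.mat k j)) :
    IsComultiplication X Δ where
  map_mat := hΔ
  map_unit e he := by
    obtain ⟨e', he', hu, -⟩ := hX
    obtain rfl := he.eq he'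
    have hmap : X.mat.map Δ = wmul X.mat X.mat := Matrix.ext hΔ
    have hunit : Δ e = minTmul e e := (hu.map Δ).eq_unit (hmap ▸ hu.wmul hu)
    exact hunit ▸ he.minTmul he

theorem MatPair.IsBiunitary.isCompactMatrixQuantumGroup [NeZero N]
    (hX : X.toMatPair.IsBiunitary) (hΔ : X.toMatPair.Maps (X.toMatPair.wprod X.toMatPair)) :
    IsCompactMatrixQuantumGroup X := by
  obtain ⟨Δ, hΔ⟩ := hΔ
  have hcomul : IsComultiplication X Δ := hX.isComultiplication hΔ
  obtain ⟨e, he, hu, hu'⟩ := hX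
  exact ⟨e, he, hu.mul_conjTranspose, hu.conjTranspose_mul,
    ⟨_, hu'.mul_conjTranspose, hu'.conjTranspose_mul⟩, Δ, hcomul⟩

/-- Slicing the second tensor factor with the counit is a left inverse of `Δ`. -/
theorem IsComultiplication.isometry {Δ : X.carrier →⋆ₙₐ[ℂ] MinTensor X.carrier X.carrier}
    (hΔ : IsComultiplication X Δ) (hε : X.toMatPair.HasCounit) : Isometry Δ := by
  obtain ⟨θ, hθ⟩ := hε.maps_wprod_left X.toMatPair
  change MinTensor X.carrier X.carrier →⋆ₙₐ[ℂ] X.carrier at θ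
  have hid : θ.comp Δ = NonUnitalStarAlgHom.id ℂ X.carrier :=
    CatObj.hom_ext _ fun i j => (congrArg θ (hΔ.map_mat i j)).trans (hθ i j)
  exact NonUnitalStarAlgHom.isometry Δ
    (Function.LeftInverse.injective (g := θ) fun x => DFunLike.congr_fun hid x)

end Comultiplication

/-! ## The models -/

section FlipMatrix

variable {n : Type*} [DecidableEq n] {A : Type u} [NonUnitalCStarAlgebra A]

/-- The matrix with `P i` at the position `(i, i)` and the complement `e - P i` at the position
`(i, σ i)`; at a fixed point of `σ` the two are added up to `e`. -/
def flipMatrix (σ : n → n) (e : A) (P : n → A) : Matrix n n A :=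
  Matrix.of fun i j => (if i = j then P i else 0) + if σ i = j then e - P i else 0

variable {σ : n → n} {e : A} {P : n → A}

theorem flipMatrix_map_star (he : IsSelfAdjoint e) (hP : ∀ i, IsSelfAdjoint (P i)) :
    (flipMatrix σ e P).map star = flipMatrix σ e P := by
  ext i j
  simp [flipMatrix, apply_ite star, he.star_eq, (hP _).star_eq]

theorem flipMatrix_transpose (hσ : Function.Involutive σ) (hPσ : ∀ i, P (σ i) = P i) :
    (flipMatrix σ e P)ᵀ = flipMatrix σ e P := by
  ext i j
  have hdiag : (if j = i then P j else 0) = if i = j then P i else 0 := by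
    split_ifs <;> simp_all
  have hflip : (if σ j = i then e - P j else 0) = if σ i = j then e - P i else 0 := by
    simp only [hσ.eq_iff, eq_comm (a := j)]
    split_ifs with h
    · rw [h, hPσ]
    · rfl
  exact congrArg₂ (· + ·) hdiag hflip

theorem flipMatrix_mul_self [Fintype n] (he : IsUnitElement e)
    (hP : ∀ i, IsIdempotentElem (P i)) (hσ : Function.Involutive σ)
    (hPσ : ∀ i, P (σ i) = P i) :
    flipMatrix σ e P * flipMatrix σ e P = Matrix.diagonal fun _ => e := by
  ext i j
  have hPP : P i * P i = P i := hP i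
  calc ∑ k, flipMatrix σ e P i k * flipMatrix σ e P k j
      = P i * flipMatrix σ e P i j + (e - P i) * flipMatrix σ e P (σ i) j := by
        simp [flipMatrix, add_mul, Finset.sum_add_distrib]
    _ = Matrix.diagonal (fun _ => e) i j := by
        simp only [flipMatrix, Matrix.of_apply, hσ i, hPσ, Matrix.diagonal_apply]
        split_ifs <;> simp [mul_sub, sub_mul, he _, hPP]

theorem isUnitaryMatrix_flipMatrix [Fintype n] (he : IsUnitElement e)
    (hP : ∀ i, IsStarProjection (P i)) (hσ : Function.Involutive σ)
    (hPσ : ∀ i, P (σ i) = P i) : IsUnitaryMatrix (flipMatrix σ e P) e := by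
  refine .of_isHermitian ?_ (flipMatrix_mul_self he (fun i => (hP i).isIdempotentElem) hσ hPσ)
  rw [Matrix.IsHermitian, Matrix.conjTranspose, flipMatrix_transpose hσ hPσ,
    flipMatrix_map_star he.isStarProjection.isSelfAdjoint fun i => (hP i).isSelfAdjoint]

end FlipMatrix

namespace TwoProj

/-- The evaluation of the universal C⋆-algebra at a representation of its relations. -/
def eval (r : TwoProjRep) : TwoProj →⋆ₙₐ[ℂ] r.alg :=
  (lpEval (fun r : TwoProjRep => r.alg) r).comp (CStarGen.incl (Set.range twoProjFamilyGen))

theorem jointlyInjective_eval : JointlyInjective eval := fun _ ha =>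
  CStarGen.incl_injective _ (jointlyInjective_lpEval _ _ ha)

theorem isStarProjection_unit : IsStarProjection unit :=
  ⟨jointlyInjective_eval.eq fun r => r.e_proj.isIdempotentElem,
    jointlyInjective_eval.eq fun r => r.e_proj.isSelfAdjoint⟩

theorem isStarProjection_p : IsStarProjection p :=
  ⟨jointlyInjective_eval.eq fun r => r.p_proj.isIdempotentElem,
    jointlyInjective_eval.eq fun r => r.p_proj.isSelfAdjoint⟩

theorem isStarProjection_q : IsStarProjection q :=
  ⟨jointlyInjective_eval.eq fun r => r.q_proj.isIdempotentElem,
    jointlyInjective_eval.eq fun r => r.q_proj.isSelfAdjoint⟩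

theorem cstarGen_unit_p_q : cstarGen {unit, p, q} = ⊤ := by
  refine cstarGen_eq_top _ _ ?_
  rintro _ ⟨k, rfl⟩
  fin_cases k
  exacts [.inl rfl, .inr (.inl rfl), .inr (.inr rfl)]

theorem isUnitElement_unit : IsUnitElement unit := by
  refine isUnitElement_of_cstarGen_eq_top cstarGen_unit_p_q isStarProjection_unit.isSelfAdjoint ?_
  rintro _ (rfl | rfl | rfl)
  · exact ⟨isStarProjection_unit.isIdempotentElem, isStarProjection_unit.isIdempotentElem⟩
  · exact ⟨jointlyInjective_eval.eq fun r => r.e_mul_p, jointlyInjective_eval.eq fun r => r.p_mul_e⟩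
  · exact ⟨jointlyInjective_eval.eq fun r => r.e_mul_q, jointlyInjective_eval.eq fun r => r.q_mul_e⟩

/-- The representation of the relations on `ℂ` with `e = p = q = 1`. -/
def trivialRep : TwoProjRep where
  alg := ℂ
  e := 1
  p := 1
  q := 1
  e_proj := .one _
  p_proj := .one _
  q_proj := .one _
  e_mul_p := one_mul _
  p_mul_e := one_mul _
  e_mul_q := one_mul _
  q_mul_e := one_mul _

end TwoProj

section Models

variable {N : ℕ} {a b c d : Fin N}

theorem matR_diag (a b c d i : Fin N) :
    (matR a b c d).mat.diag i =
      if i = a ∨ i = b then TwoProj.p else if i = c ∨ i = d then TwoProj.q else TwoProj.unit :=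
  if_pos rfl

theorem isStarProjection_matR_diag (a b c d i : Fin N) :
    IsStarProjection ((matR a b c d).mat.diag i) := by
  rw [matR_diag]
  split_ifs
  exacts [TwoProj.isStarProjection_p, TwoProj.isStarProjection_q, TwoProj.isStarProjection_unit]

theorem swap_mul_swap_involutive (h : [a, b, c, d].Nodup) :
    Function.Involutive (Equiv.swap a b * Equiv.swap c d) := by
  intro i
  simp only [Equiv.Perm.mul_apply, Equiv.swap_apply_def]
  grind

theorem matR_diag_swap_mul_swap (h : [a, b, c, d].Nodup) (i : Fin N) :
    (matR a b c d).mat.diag ((Equiv.swap a b * Equiv.swap c d) i) =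
      (matR a b c d).mat.diag i := by
  simp only [matR_diag, Equiv.Perm.mul_apply, Equiv.swap_apply_def]
  grind

theorem matR_eq_flipMatrix (h : [a, b, c, d].Nodup) :
    (matR a b c d).mat = flipMatrix (Equiv.swap a b * Equiv.swap c d)
      TwoProj.unit (matR a b c d).mat.diag := by
  ext i j
  by_cases hij : i = j
  · subst hij
    simp only [flipMatrix, Matrix.of_apply, matR_diag, if_true,
      Equiv.Perm.mul_apply, Equiv.swap_apply_def]
    simp only [matR]
    split_ifs <;> simp_all
  · simp only [flipMatrix, Matrix.of_apply, matR_diag, if_neg hij,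
      Equiv.Perm.mul_apply, Equiv.swap_apply_def, zero_add]
    simp only [matR]
    split_ifs <;> grind

theorem isBiunitary_matR (h : [a, b, c, d].Nodup) : (matR a b c d).IsBiunitary := by
  have hP := isStarProjection_matR_diag a b c d
  have hu : IsUnitaryMatrix (matR a b c d).mat TwoProj.unit := by
    rw [matR_eq_flipMatrix h]
    exact isUnitaryMatrix_flipMatrix TwoProj.isUnitElement_unit hP (swap_mul_swap_involutive h)
      (matR_diag_swap_mul_swap h)
  have hstar : (matR a b c d).mat.map star = (matR a b c d).mat := by
    rw [matR_eq_flipMatrix h]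
    exact flipMatrix_map_star TwoProj.isStarProjection_unit.isSelfAdjoint
      fun i => (hP i).isSelfAdjoint
  exact ⟨_, TwoProj.isUnitElement_unit, hu, hstar.symm ▸ hu⟩

theorem hasCounit_matR (a b c d : Fin N) : (matR a b c d).HasCounit := by
  let φ : TwoProj →⋆ₙₐ[ℂ] ℂ := TwoProj.eval TwoProj.trivialRep
  have hunit : φ TwoProj.unit = 1 := rfl
  have hp : φ TwoProj.p = 1 := rfl
  have hq : φ TwoProj.q = 1 := rfl
  refine ⟨φ, fun i j => ?_⟩
  change φ (if i = j then
      if i = a ∨ i = b then TwoProj.p else if i = c ∨ i = d then TwoProj.q else TwoProj.unit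
    else if (i = a ∧ j = b) ∨ (i = b ∧ j = a) then TwoProj.unit - TwoProj.p
    else if (i = c ∧ j = d) ∨ (i = d ∧ j = c) then TwoProj.unit - TwoProj.q
    else 0) = (1 : Matrix (Fin N) (Fin N) ℂ) i j
  rw [Matrix.one_apply]
  split_ifs <;> simp [hunit, hp, hq]

theorem modelOne_induction {p : MatPair.{1} N → Prop} (L : ℕ+) {c d : Fin N → Fin N → Fin N}
    {p₀ : Fin N × Fin N} {ps : List (Fin N × Fin N)}
    (hp : ∀ X Y, p X → p Y → p (X.wprod Y)) (hgen : ∀ X, p X → p X.generatedObj.toMatPair)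
    (hR : ∀ x ∈ p₀ :: ps, p (matR x.1 x.2 (c x.1 x.2) (d x.1 x.2))) :
    p (modelOne L c d p₀ ps).toMatPair := by
  refine hgen _ (MatPair.wpow_induction hp (MatPair.wprodList_induction hp
    (hR p₀ List.mem_cons_self) fun Y hY => ?_) L)
  obtain ⟨x, hx, rfl⟩ := List.mem_map.mp hY
  exact hR x (List.mem_cons_of_mem _ hx)

theorem isBiunitary_modelOne [NeZero N] (L : ℕ+) {c d : Fin N → Fin N → Fin N}
    {p₀ : Fin N × Fin N} {ps : List (Fin N × Fin N)}
    (h : ∀ x ∈ p₀ :: ps, [x.1, x.2, c x.1 x.2, d x.1 x.2].Nodup) :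
    (modelOne L c d p₀ ps).toMatPair.IsBiunitary :=
  modelOne_induction L (fun _ _ hX hY => hX.wprod hY) (fun _ hX => hX.generatedObj)
    fun x hx => isBiunitary_matR (h x hx)

theorem hasCounit_modelOne (L : ℕ+) (c d : Fin N → Fin N → Fin N) (p₀ : Fin N × Fin N)
    (ps : List (Fin N × Fin N)) : (modelOne L c d p₀ ps).toMatPair.HasCounit :=
  modelOne_induction L (fun _ _ hX hY => hX.wprod hY) (fun X hX => hX.of_maps X.maps_generatedObj)
    fun _ _ => hasCounit_matR _ _ _ _

end Models

/-! ## The inverse system of powers -/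

namespace CatObj

variable {N : ℕ} {X : CatObj.{u} N}

theorem nonempty_arrow_model (hε : X.toMatPair.HasCounit) (n : ℕ) :
    Nonempty (CatArrow (X.model (n + 1).succPNat) (X.model n.succPNat)) := by
  have hn : (n + 1).succPNat = n.succPNat + 1 := rfl
  refine MatPair.Maps.nonempty_catArrow ?_
  rw [hn, MatPair.wpow_add_one]
  exact hε.maps_wprod_left _

end CatObj

theorem mainTheorem1_general {N : ℕ} [NeZero N] (X : CatObj.{u} N)
    (hX : X.toMatPair.IsBiunitary) (hε : X.toMatPair.HasCounit) :
    ∃ π : ∀ n : ℕ, CatArrow (X.model (n + 1).succPNat) (X.model n.succPNat),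
      (∃ C : CatCone (D := fun n => X.model n.succPNat) π, C.IsInverseLimit) ∧
      ∀ C : CatCone (D := fun n => X.model n.succPNat) π, C.IsInverseLimit →
        IsCompactMatrixQuantumGroup C.pt ∧
        ∀ Δ : C.pt.carrier →⋆ₙₐ[ℂ] MinTensor C.pt.carrier C.pt.carrier,
          IsComultiplication C.pt Δ → Isometry Δ := by
  let P : ℕ → MatPair.{u} N := fun n => X.toMatPair.wpow n.succPNat
  have hP : ∀ n, (P n).IsBiunitary := fun n => MatPair.wpow_induction (fun _ _ => .wprod) hX _
  have π (n : ℕ) : CatArrow (X.model (n + 1).succPNat) (X.model n.succPNat) :=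
    Classical.choice (CatObj.nonempty_arrow_model hε n)
  have hbdd (i j : Fin N) : BddAbove (Set.range fun n : ℕ => ‖(X.model n.succPNat).mat i j‖) :=
    ⟨1, Set.forall_mem_range.mpr fun n => (hP n).generatedObj.norm_mat_le i j⟩
  refine ⟨π, ⟨limitCone hbdd π, limitCone_isInverseLimit hbdd π⟩, fun C hC => ?_⟩
  let r : ∀ n, C.pt.carrier →⋆ₙₐ[ℂ] (P n).carrier := fun n =>
    (P n).generatedIncl.comp (C.arrow n).hom
  have hr_mat : ∀ n i j, r n (C.pt.mat i j) = (P n).mat i j := fun n i j =>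
    congrArg (P n).generatedIncl ((C.arrow n).map_mat i j)
  have hr : JointlyInjective r := fun x hx => hC.jointlyInjective x fun n =>
    (map_eq_zero_iff _ (P n).generatedIncl_injective).mp (hx n)
  have hpt : C.pt.toMatPair.IsBiunitary := .of_jointlyInjective hr hr_mat hP
  have hΔ : C.pt.toMatPair.Maps (C.pt.toMatPair.wprod C.pt.toMatPair) :=
    CatObj.maps_wprod_self hr hr_mat (MatPair.Maps.wpow_wprod_wpow fun n => ⟨r n, hr_mat n⟩)
  exact ⟨hpt.isCompactMatrixQuantumGroup hΔ, fun Δ hcomul =>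
    hcomul.isometry (hε.of_maps ⟨r 0, hr_mat 0⟩)⟩

end

theorem mainTheorem1 (N : ℕ) (hN : 4 ≤ N)
    (L : ℕ+)
    (hL : ∀ σ : Equiv.Perm (Fin N), ∃ l : List (Equiv.Perm (Fin N)),
      l.length ≤ L ∧ (∀ τ ∈ l, τ.IsSwap) ∧ l.prod = σ)
    (c d : Fin N → Fin N → Fin N)
    (hcd : ∀ a b : Fin N, a < b → [a, b, c a b, d a b].Nodup)
    (p₀ : Fin N × Fin N) (ps : List (Fin N × Fin N))
    (hnodup : (p₀ :: ps).Nodup)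
    (hpairs : ∀ p : Fin N × Fin N, p ∈ p₀ :: ps ↔ p.1 < p.2) :
    ∃ π : ∀ n : ℕ,
        CatArrow ((modelOne L c d p₀ ps).model (n + 1).succPNat)
          ((modelOne L c d p₀ ps).model n.succPNat),
      (∃ C : CatCone (D := fun n => (modelOne L c d p₀ ps).model n.succPNat) π,
        C.IsInverseLimit) ∧
      ∀ C : CatCone (D := fun n => (modelOne L c d p₀ ps).model n.succPNat) π,
        C.IsInverseLimit →
          IsCompactMatrixQuantumGroup C.pt ∧
          ∀ Δ : C.pt.carrier →⋆ₙₐ[ℂ] MinTensor C.pt.carrier C.pt.carrier,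
            IsComultiplication C.pt Δ → Isometry Δ :=
  haveI : NeZero N := ⟨by lia⟩
  mainTheorem1_general _ (isBiunitary_modelOne L fun p hp => hcd _ _ ((hpairs p).mp hp))
    (hasCounit_modelOne L c d p₀ ps)
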